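/- **Setting.** For each pair of positive integers $r,c$ let $K_{ij}=K_{ij}^{(r,c)}\ge 0$ ($1\le i\le r$, $1\le j\le c$) be integers (cell counts), let $\mathcal E=\{(i,j):K_{ij}\ge1\}$ be the set of observed cells, and let $\eta_{ij}=\mu+\alpha_i+\beta_j$ be cell means, where $\mu\in\mathbb R$, $\alpha\in\mathbb R^r$, $\beta\in\mathbb R^c$ may depend on $(r,c)$. One observes independent $y_{ij}\sim N(\eta_{ij},\sigma^2/K_{ij})$, $(i,j)\in\mathcal E$, with known fixed $\sigma>0$. Write $\eta_c=(\eta_{ij})_{\text{all }(i,j)}$, $\eta=(\eta_{ij})_{\mathcal E}$, $y=(y_{ij})_{\mathcal E}$, $M=\mathrm{diag}(K_{ij}^{-1})_{\mathcal E}$. Let $Z_c$ be the $rc\times(r+c)$ design matrix of row and column indicators and let $Z$ consist of its rows with index in $\mathcal E$. All cell means are assumed estimable: $\mathrm{rank}\,Z=\mathrm{rank}\,Z_c$. Let $Z^\dagger$ be the Moore–Penrose inverse of $Z$, $Q=(Z_cZ^\dagger)^{\mathsf T}Z_cZ^\dagger$, and let $\lambda_1(Q)$ be its largest eigenvalue.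 For $\mu'\in\mathbb R$ and $\lambda_A,\lambda_B\ge 0$ put $\Lambda\Lambda^{\mathsf T}=\mathrm{diag}(\lambda_A I_r,\lambda_B I_c)$, $\Sigma=Z\Lambda\Lambda^{\mathsf T}Z^{\mathsf T}+M$ and $$\hat\eta^{S}(\mu',\lambda_A,\lambda_B)=y-M\Sigma^{-1}(y-\mu'\mathbf 1),$$ $$\widehat{\mathrm{URE}}{}^Q(\mu',\lambda_A,\lambda_B)=\frac1{rc}\Big\{\sigma^2\,\mathrm{tr}(QM)-2\sigma^2\,\mathrm{tr}(\Sigma^{-1}MQM)+(y-\mu'\mathbf 1)^{\mathsf T}\Sigma^{-1}MQM\Sigma^{-1}(y-\mu'\mathbf 1)\Big\},$$ where $\Sigma^{-1}$ is extended by continuity to $(\lambda_A,\lambda_B)\in[0,\infty]^2$. The loss is $L(\eta_c,\hat\eta_c)=\frac1{rc}\|\hat\eta_c-\eta_c\|^2$. Fix $\tau\in(0,1]$, let $\hat a_\tau,\hat b_\tau$ be the empirical $\tau/2$ and $1-\tau/2$ quantiles of $\{y_{ij}:(i,j)\in\mathcal E\}$ (where the empirical $q$-quantile is the smallest $x$ such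 that at least a fraction $q$ of the observations is $\le x$), and let $\hat T_{r,c}=[\hat a_\tau,\hat b_\tau]\times[0,\infty]\times[0,\infty]$. Let $$\hat\eta_c^{\rm URE}=Z_cZ^\dagger\hat\eta^S(\hat\mu,\hat\lambda_A,\hat\lambda_B),\qquad \tilde\eta_c^{\rm OL}=Z_cZ^\dagger\hat\eta^S(\tilde\mu,\tilde\lambda_A,\tilde\lambda_B),$$ where $(\hat\mu,\hat\lambda_A,\hat\lambda_B)$ is any minimizer of $\widehat{\mathrm{URE}}{}^Q$ over $\hat T_{r,c}$ and $(\tilde\mu,\tilde\lambda_A,\tilde\lambda_B)$ is any minimizer over $\hat T_{r,c}$ of the actual loss $L(\eta_c,Z_cZ^\dagger\hat\eta^S(\cdot))$. **Assumptions.** A1. $\frac1{rc}\sum_{(i,j)\in\mathcal E}\eta_{ij}^2=O(1)$ as $r,c\to\infty$. A2. $(rc)^{-1/8}\,(\log(rc))^2\,\nu_{r,c}\,\lambda_1(Q)\to0$ as $r,c\to\infty$, where $\nu_{r,c}=\max_{(i,j)\in\mathcal E}K_{ij}\big/\min_{(i,j)\in\mathcal E}K_{ij}$. **Theorem.** Under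 A1 and A2, for every $\epsilon>0$, $$P\big\{L(\eta_c,\hat\eta_c^{\rm URE})\ \ge\ L(\eta_c,\tilde\eta_c^{\rm OL})+\epsilon\big\}\longrightarrow 0\qquad\text{as } r,c\to\infty .$$ -/

import Mathlib

open Filter Topology MeasureTheory ProbabilityTheory Matrix
open scoped ENNReal NNReal

namespace TwoWay

/-! ### Moore-Penrose inverse and largest eigenvalue -/

/-- The four Penrose equations: `B` is the Moore-Penrose inverse of the real matrix `A`. -/
def IsMoorePenrose {m n : Type*} [Fintype m] [Fintype n]
    (A : Matrix m n ℝ) (B : Matrix n m ℝ) : Prop :=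
  A * B * A = A ∧ B * A * B = B ∧ (A * B)ᵀ = A * B ∧ (B * A)ᵀ = B * A

/-- Every real matrix has a Moore-Penrose inverse. -/
theorem exists_isMoorePenrose {m n : Type*} [Fintype m] [Fintype n]
    (A : Matrix m n ℝ) : ∃ B : Matrix n m ℝ, IsMoorePenrose A B := by
  classical
  have hX : (Aᵀ * A).IsHermitian := by
    simpa using isHermitian_conjTranspose_mul_self A
  obtain ⟨S, hXSX, hSXS, hXS, hSX, hSt⟩ : ∃ S : Matrix n n ℝ,
      (Aᵀ * A) * S * (Aᵀ * A) = Aᵀ * A ∧ S * (Aᵀ * A) * S = S ∧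
      ((Aᵀ * A) * S)ᵀ = (Aᵀ * A) * S ∧ (S * (Aᵀ * A))ᵀ = S * (Aᵀ * A) ∧ Sᵀ = S := by
    have hT : ∀ M : Matrix n n ℝ, Mᵀ = star M := fun M => by
      rw [star_eq_conjTranspose]; simp
    obtain ⟨φ, d, hsp⟩ : ∃ (φ : Matrix n n ℝ ≃⋆ₐ[ℝ] Matrix n n ℝ) (d : n → ℝ),
        Aᵀ * A = φ (diagonal d) :=
      ⟨Unitary.conjStarAlgAut ℝ (Matrix n n ℝ) hX.eigenvectorUnitary, hX.eigenvalues,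
        hX.spectral_theorem⟩
    rw [hsp]
    refine ⟨φ (diagonal fun i => (d i)⁻¹), ?_, ?_, ?_, ?_, ?_⟩ <;>
      simp only [hT, ← map_mul, ← map_star, diagonal_mul_diagonal] <;>
      congr 1 <;> first
        | (rw [star_eq_conjTranspose, diagonal_conjTranspose]; congr 1)
        | (congr 1; ext i; by_cases h : d i = 0 <;> simp [h])
  refine ⟨S * Aᵀ, ?_, ?_, ?_, ?_⟩
  · have h0 : (A * S * (Aᵀ * A) - A)ᵀ * (A * S * (Aᵀ * A) - A) = 0 := by
      have e : A * S * (Aᵀ * A) - A = A * (S * (Aᵀ * A) - 1) := by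
        simp [Matrix.mul_sub, Matrix.mul_assoc]
      rw [e, transpose_mul, Matrix.mul_assoc, ← Matrix.mul_assoc Aᵀ, Matrix.mul_sub,
        ← Matrix.mul_assoc (Aᵀ * A) S, hXSX]
      simp
    have h1 : A * S * (Aᵀ * A) - A = 0 := by
      rw [← conjTranspose_mul_self_eq_zero (R := ℝ)]
      simpa using h0
    have := sub_eq_zero.1 h1
    simpa [Matrix.mul_assoc] using this
  · calc S * Aᵀ * A * (S * Aᵀ) = (S * (Aᵀ * A) * S) * Aᵀ := by simp [Matrix.mul_assoc]
      _ = S * Aᵀ := by rw [hSXS]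
  · simp [transpose_mul, hSt, Matrix.mul_assoc]
  · simpa [Matrix.mul_assoc] using hSX

/-- The Moore-Penrose inverse of a real matrix. -/
noncomputable def pinv {m n : Type*} [Fintype m] [Fintype n] (A : Matrix m n ℝ) : Matrix n m ℝ :=
  Classical.choose (exists_isMoorePenrose A)

theorem pinv_spec {m n : Type*} [Fintype m] [Fintype n] (A : Matrix m n ℝ) :
    IsMoorePenrose A (pinv A) :=
  Classical.choose_spec (exists_isMoorePenrose A)

/-- The largest eigenvalue of a (symmetric) real matrix. -/
noncomputable def lambdaMax {n : Type*} [Fintype n] [DecidableEq n] (A : Matrix n n ℝ) : ℝ :=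
  sSup (spectrum ℝ A)

/-! ### The unbalanced two-way additive design with missing cells

`K i j` is the number of observations in cell `(i, j)`; the cell is missing when `K i j = 0`. -/

variable {r c : ℕ}

/-- The observed cells. -/
abbrev Obs (K : Fin r → Fin c → ℕ) : Type := {p : Fin r × Fin c // 0 < K p.1 p.2}

/-- The design matrix of all `r * c` cells: row indicators followed by column indicators. -/
def fullDesign (r c : ℕ) : Matrix (Fin r × Fin c) (Fin r ⊕ Fin c) ℝ :=
  Matrix.of fun p => Sum.elim (fun i => if p.1 = i then 1 else 0) (fun j => if p.2 = j then 1 else 0)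

/-- The design matrix of the observed cells. -/
def obsDesign (K : Fin r → Fin c → ℕ) : Matrix (Obs K) (Fin r ⊕ Fin c) ℝ :=
  (fullDesign r c).submatrix Subtype.val id

/-- All cell means are estimable from the observed cells: deleting the rows of the missing cells
does not lower the rank of the design matrix. -/
def Estimable (K : Fin r → Fin c → ℕ) : Prop :=
  (obsDesign K).rank = (fullDesign r c).rank

/-- The cell means `μ + α i + β j` of the additive model. -/
def cellMean (μ : ℝ) (α : Fin r → ℝ) (β : Fin c → ℝ) : Fin r × Fin c → ℝ :=
  fun p => μ + α p.1 + β p.2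

/-- `M`, the diagonal matrix of the `1 / K i j` over the observed cells. -/
noncomputable def covM (K : Fin r → Fin c → ℕ) : Matrix (Obs K) (Obs K) ℝ :=
  Matrix.diagonal fun e => ((K e.1.1 e.1.2 : ℕ) : ℝ)⁻¹

/-- `Σ = Z Λ Λᵀ Zᵀ + M` with `Λ Λᵀ = diag (lA I, lB I)`, for finite `lA`, `lB`. -/
noncomputable def sigmaMat (K : Fin r → Fin c → ℕ) (lA lB : ℝ) : Matrix (Obs K) (Obs K) ℝ :=
  obsDesign K * (Matrix.diagonal (Sum.elim (fun _ => lA) (fun _ => lB)) :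
    Matrix (Fin r ⊕ Fin c) (Fin r ⊕ Fin c) ℝ) * (obsDesign K)ᵀ + covM K

/-- `Σ⁻¹` as a function of `(lA, lB) ∈ [0, ∞]²`, extended from finite values by continuity
(see `tendsto_sigmaInv` and `continuous_sigmaInv`). -/
noncomputable def sigmaInv (K : Fin r → Fin c → ℕ) (l : ℝ≥0∞ × ℝ≥0∞) :
    Matrix (Obs K) (Obs K) ℝ :=
  extendFrom {l : ℝ≥0∞ × ℝ≥0∞ | l.1 ≠ ⊤ ∧ l.2 ≠ ⊤}
    (fun l => (sigmaMat K l.1.toReal l.2.toReal)⁻¹) l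

/-- A value `(μ, lA, lB)` of the hyper-parameters. -/
abbrev Hyper : Type := ℝ × ℝ≥0∞ × ℝ≥0∞

/-- The Bayes rule `y - M Σ⁻¹ (y - μ 1)` for the means of the observed cells. -/
noncomputable def shrink (K : Fin r → Fin c → ℕ) (h : Hyper) (y : Obs K → ℝ) : Obs K → ℝ :=
  y - (covM K * sigmaInv K h.2) *ᵥ (y - fun _ => h.1)

/-- `Z_c Z†`, which maps the means of the observed cells to the means of all cells. -/
noncomputable def extrapolate (K : Fin r → Fin c → ℕ) : Matrix (Fin r × Fin c) (Obs K) ℝ :=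
  fullDesign r c * pinv (obsDesign K)

/-- The estimator `Z_c Z† (y - M Σ⁻¹ (y - μ 1))` of all cell means. -/
noncomputable def cellEstimator (K : Fin r → Fin c → ℕ) (h : Hyper) (y : Obs K → ℝ) :
    Fin r × Fin c → ℝ :=
  extrapolate K *ᵥ shrink K h y

/-- The normalized sum-of-squares loss over all cells. -/
noncomputable def loss (η est : Fin r × Fin c → ℝ) : ℝ :=
  ((r : ℝ) * (c : ℝ))⁻¹ * ∑ p, (est p - η p) ^ 2

/-- `Q = (Z_c Z†)ᵀ (Z_c Z†)`. -/
noncomputable def lossQ (K : Fin r → Fin c → ℕ) : Matrix (Obs K) (Obs K) ℝ :=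
  (extrapolate K)ᵀ * extrapolate K

/-- The unbiased risk estimate of `cellEstimator K h` when the noise has variance `σ²`. -/
noncomputable def ure (K : Fin r → Fin c → ℕ) (σ : ℝ) (y : Obs K → ℝ) (h : Hyper) : ℝ :=
  ((r : ℝ) * (c : ℝ))⁻¹ *
    (σ ^ 2 * (lossQ K * covM K).trace
      - 2 * σ ^ 2 * (sigmaInv K h.2 * covM K * lossQ K * covM K).trace
      + (y - fun _ => h.1) ⬝ᵥ
          ((sigmaInv K h.2 * covM K * lossQ K * covM K * sigmaInv K h.2) *ᵥ (y - fun _ => h.1)))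

/-- The empirical `q`-quantile of the values of `y`. -/
noncomputable def quantile {ι : Type*} [Fintype ι] (y : ι → ℝ) (q : ℝ) : ℝ :=
  sInf {x : ℝ | q * (Fintype.card ι : ℝ) ≤ (({i | y i ≤ x} : Set ι).ncard : ℝ)}

/-- The hyper-parameter domain: `μ` between the `τ/2` and the `1 - τ/2` quantile of the
observations, and `lA, lB ∈ [0, ∞]`. -/
noncomputable def hyperDomain (K : Fin r → Fin c → ℕ) (τ : ℝ) (y : Obs K → ℝ) : Set Hyper :=
  Set.Icc (quantile y (τ / 2)) (quantile y (1 - τ / 2)) ×ˢ Set.univ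

/-- `h` is a hyper-parameter choice that minimizes the unbiased risk estimate. -/
def IsURETuning (K : Fin r → Fin c → ℕ) (σ τ : ℝ) (y : Obs K → ℝ) (h : Hyper) : Prop :=
  h ∈ hyperDomain K τ y ∧ IsMinOn (ure K σ y) (hyperDomain K τ y) h

/-- `h` is a hyper-parameter choice that minimizes the actual loss (the oracle). -/
def IsOracleTuning (K : Fin r → Fin c → ℕ) (τ : ℝ) (η : Fin r × Fin c → ℝ) (y : Obs K → ℝ)
    (h : Hyper) : Prop :=
  h ∈ hyperDomain K τ y ∧
    IsMinOn (fun h => loss η (cellEstimator K h y)) (hyperDomain K τ y) h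

/-- The law of the observed vector: independent coordinates `y i j ~ N(η i j, σ² / K i j)`. -/
noncomputable def obsLaw (K : Fin r → Fin c → ℕ) (σ : ℝ) (η : Fin r × Fin c → ℝ) :
    Measure (Obs K → ℝ) :=
  Measure.pi fun e => gaussianReal (η e.1) (Real.toNNReal (σ ^ 2 / (K e.1.1 e.1.2 : ℝ)))

/-- The imbalance `max K / min K` over the observed cells. -/
noncomputable def imbalance (K : Fin r → Fin c → ℕ) : ℝ :=
  (⨆ e : Obs K, (K e.1.1 e.1.2 : ℝ)) / (⨅ e : Obs K, (K e.1.1 e.1.2 : ℝ))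

/-! ### `sigmaInv` is a genuine continuous extension and the tuning parameters exist -/

theorem dotProduct_sigma_mulVec {E J : Type*} [Fintype E] [Fintype J] [DecidableEq E]
    [DecidableEq J] (Z : Matrix E J ℝ) (m : E → ℝ) (d : J → ℝ) (v w : E → ℝ) :
    v ⬝ᵥ ((Z * diagonal d * Zᵀ + diagonal m) *ᵥ w) =
      ∑ q, d q * ((Zᵀ *ᵥ v) q * (Zᵀ *ᵥ w) q) + ∑ e, m e * (v e * w e) := by
  rw [add_mulVec, dotProduct_add, ← mulVec_mulVec, ← mulVec_mulVec, dotProduct_mulVec,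
    ← mulVec_transpose]
  congr 1
  · simp only [dotProduct, mulVec_diagonal]
    exact Finset.sum_congr rfl fun q _ => by ring
  · simp only [dotProduct, mulVec_diagonal]
    exact Finset.sum_congr rfl fun q _ => by ring

/-- If some variance components tend to infinity and the others converge, `Σ⁻¹` converges. -/
theorem exists_tendsto_inv {T E J : Type*} [Fintype E] [Fintype J] [DecidableEq E] [DecidableEq J]
    (Z : Matrix E J ℝ) (m : E → ℝ) (hm : ∀ e, 0 < m e) (F : Filter T) [F.NeBot] (d : T → J → ℝ)
    (h0 : ∀ t q, 0 ≤ d t q) (I : Set J) (d0 : J → ℝ)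
    (hinf : ∀ q ∈ I, Tendsto (fun t => d t q) F atTop)
    (hfin : ∀ q ∉ I, Tendsto (fun t => d t q) F (𝓝 (d0 q))) :
    ∃ X, Tendsto (fun t => (Z * diagonal (d t) * Zᵀ + diagonal m)⁻¹) F (𝓝 X) := by
  classical
  set S : T → Matrix E E ℝ := fun t => Z * diagonal (d t) * Zᵀ + diagonal m with hS
  have hbil : ∀ t v w, v ⬝ᵥ (S t *ᵥ w) =
      ∑ q, d t q * ((Zᵀ *ᵥ v) q * (Zᵀ *ᵥ w) q) + ∑ e, m e * (v e * w e) :=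
    fun t v w => dotProduct_sigma_mulVec Z m (d t) v w
  have hSS : ∀ t, S t * (S t)⁻¹ = 1 := fun t => by
    have h1 : (Z * diagonal (d t) * Zᵀ).PosSemidef := by
      simpa using (PosSemidef.diagonal (h0 t)).mul_mul_conjTranspose_same Z
    have h2 : (S t).PosDef := PosDef.posSemidef_add h1 (PosDef.diagonal hm)
    exact mul_nonsing_inv _ ((isUnit_iff_isUnit_det _).1 h2.isUnit)
  have hSx : ∀ t x, S t *ᵥ ((S t)⁻¹ *ᵥ x) = x := fun t x => by
    rw [mulVec_mulVec, hSS, one_mulVec]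
  have hquad : ∀ t x, ((S t)⁻¹ *ᵥ x) ⬝ᵥ x =
      ∑ q, d t q * ((Zᵀ *ᵥ ((S t)⁻¹ *ᵥ x)) q * (Zᵀ *ᵥ ((S t)⁻¹ *ᵥ x)) q) +
        ∑ e, m e * (((S t)⁻¹ *ᵥ x) e * ((S t)⁻¹ *ᵥ x) e) := fun t x => by
    rw [← hbil, hSx]
  have hq0 : ∀ t w, 0 ≤ ∑ q, d t q * ((Zᵀ *ᵥ w) q * (Zᵀ *ᵥ w) q) := fun t w =>
    Finset.sum_nonneg fun q _ => mul_nonneg (h0 t q) (mul_self_nonneg _)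
  have he0 : ∀ w : E → ℝ, 0 ≤ ∑ e, m e * (w e * w e) := fun w =>
    Finset.sum_nonneg fun e _ => mul_nonneg (hm e).le (mul_self_nonneg _)
  have hqle : ∀ t x q, d t q * ((Zᵀ *ᵥ ((S t)⁻¹ *ᵥ x)) q) ^ 2 ≤ ((S t)⁻¹ *ᵥ x) ⬝ᵥ x := by
    intro t x q
    have h1 := Finset.single_le_sum
      (f := fun q => d t q * ((Zᵀ *ᵥ ((S t)⁻¹ *ᵥ x)) q * (Zᵀ *ᵥ ((S t)⁻¹ *ᵥ x)) q))
      (fun q _ => mul_nonneg (h0 t q) (mul_self_nonneg _)) (Finset.mem_univ q)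
    have h2 := he0 ((S t)⁻¹ *ᵥ x)
    have h3 := hquad t x
    rw [sq]
    linarith
  have hele : ∀ t x e, m e * (((S t)⁻¹ *ᵥ x) e) ^ 2 ≤ ((S t)⁻¹ *ᵥ x) ⬝ᵥ x := by
    intro t x e
    have h1 := Finset.single_le_sum
      (f := fun e => m e * (((S t)⁻¹ *ᵥ x) e * ((S t)⁻¹ *ᵥ x) e))
      (fun e _ => mul_nonneg (hm e).le (mul_self_nonneg _)) (Finset.mem_univ e)
    have h2 := hq0 t ((S t)⁻¹ *ᵥ x)
    have h3 := hquad t x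
    rw [sq]
    linarith
  have hbd : ∀ t i j, |(S t)⁻¹ i j| ≤ ∑ e, (m e)⁻¹ := by
    intro t i j
    have hw : ∀ k, ((S t)⁻¹ *ᵥ Pi.single j 1) k = (S t)⁻¹ k j := fun k => by simp
    have hj := hele t (Pi.single j 1) j
    have hi := hele t (Pi.single j 1) i
    rw [dotProduct_single_one, hw] at hj hi
    rw [hw] at hi
    have hBi : (m i)⁻¹ ≤ ∑ e, (m e)⁻¹ := Finset.single_le_sum
      (f := fun e => (m e)⁻¹) (fun e _ => (inv_pos.2 (hm e)).le) (Finset.mem_univ i)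
    have hBj : (m j)⁻¹ ≤ ∑ e, (m e)⁻¹ := Finset.single_le_sum
      (f := fun e => (m e)⁻¹) (fun e _ => (inv_pos.2 (hm e)).le) (Finset.mem_univ j)
    have hjj : (S t)⁻¹ j j ≤ (m j)⁻¹ := by
      rw [← one_div (m j), le_div_iff₀ (hm j)]
      by_contra! h
      nlinarith [hm j, sq_nonneg ((S t)⁻¹ j j)]
    have hii : ((S t)⁻¹ i j) ^ 2 ≤ (m i)⁻¹ * (m j)⁻¹ := by
      rw [inv_mul_eq_div, le_div_iff₀ (hm i)]
      nlinarith
    have hB0 : 0 ≤ ∑ e, (m e)⁻¹ := (inv_pos.2 (hm i)).le.trans hBi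
    refine abs_le_of_sq_le_sq (hii.trans ?_) hB0
    rw [sq]
    exact mul_le_mul hBi hBj (inv_pos.2 (hm j)).le hB0
  set C : Set (Matrix E E ℝ) :=
    Set.univ.pi fun _ => Set.univ.pi fun _ => Set.Icc (-∑ e, (m e)⁻¹) (∑ e, (m e)⁻¹) with hC
  have hCc : IsCompact C := isCompact_univ_pi fun _ => isCompact_univ_pi fun _ => isCompact_Icc
  have hmem : ∀ t, (S t)⁻¹ ∈ C := fun t i _ j _ => abs_le.1 (hbd t i j)
  -- properties of cluster points
  have hP1 : ∀ X, MapClusterPt X F (fun t => (S t)⁻¹) →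
      ∀ x, ∀ q ∈ I, (Zᵀ *ᵥ (X *ᵥ x)) q = 0 := by
    intro X hX x q hq
    obtain ⟨U, hU, hUX⟩ := mapClusterPt_iff_ultrafilter.1 hX
    have hc1 : Continuous fun Y : Matrix E E ℝ => ((Zᵀ *ᵥ (Y *ᵥ x)) q) ^ 2 := by fun_prop
    have hc2 : Continuous fun Y : Matrix E E ℝ => (Y *ᵥ x) ⬝ᵥ x := by fun_prop
    have t1 := (hc1.tendsto X).comp hUX
    have t2 := ((hc2.tendsto X).comp hUX).mul ((hinf q hq).mono_left hU).inv_tendsto_atTop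
    have hle := le_of_tendsto_of_tendsto t1 t2 (by
      filter_upwards [((hinf q hq).mono_left hU).eventually_gt_atTop 0] with t ht
      have := hqle t x q
      simp only [Function.comp, Pi.inv_apply]
      rw [← div_eq_mul_inv, le_div_iff₀ ht]
      linarith)
    rw [mul_zero] at hle
    exact pow_eq_zero_iff (two_ne_zero) |>.1 (le_antisymm hle (sq_nonneg _))
  have hP2 : ∀ X, MapClusterPt X F (fun t => (S t)⁻¹) →
      ∀ v, (∀ q ∈ I, (Zᵀ *ᵥ v) q = 0) → ∀ x,
        ∑ q, (if q ∈ I then 0 else d0 q) * ((Zᵀ *ᵥ v) q * (Zᵀ *ᵥ (X *ᵥ x)) q) +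
          ∑ e, m e * (v e * (X *ᵥ x) e) = v ⬝ᵥ x := by
    intro X hX v hv x
    obtain ⟨U, hU, hUX⟩ := mapClusterPt_iff_ultrafilter.1 hX
    have hc1 : ∀ q, Continuous fun Y : Matrix E E ℝ => (Zᵀ *ᵥ v) q * (Zᵀ *ᵥ (Y *ᵥ x)) q :=
      fun q => by fun_prop
    have hc2 : ∀ e, Continuous fun Y : Matrix E E ℝ => m e * (v e * (Y *ᵥ x) e) :=
      fun e => by fun_prop
    have t1 : Tendsto (fun t => v ⬝ᵥ (S t *ᵥ ((S t)⁻¹ *ᵥ x))) U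
        (𝓝 (∑ q, (if q ∈ I then 0 else d0 q) * ((Zᵀ *ᵥ v) q * (Zᵀ *ᵥ (X *ᵥ x)) q) +
          ∑ e, m e * (v e * (X *ᵥ x) e))) := by
      simp only [hbil]
      refine (tendsto_finsetSum _ fun q _ => ?_).add
        (tendsto_finsetSum _ fun e _ => ((hc2 e).tendsto X).comp hUX)
      by_cases hq : q ∈ I
      · simp [hv q hq]
      · simpa [hq] using ((hfin q hq).mono_left hU).mul (((hc1 q).tendsto X).comp hUX)
    simp only [hSx] at t1
    exact tendsto_nhds_unique t1 tendsto_const_nhds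
  obtain ⟨X, -, hX⟩ := hCc.exists_mapClusterPt (f := F) (u := fun t => (S t)⁻¹)
    (by rw [le_principal_iff]; exact Filter.mem_map.2 (Eventually.of_forall hmem))
  refine ⟨X, hCc.tendsto_nhds_of_unique_mapClusterPt (Eventually.of_forall hmem) ?_⟩
  intro Y _ hY
  have hd0 : ∀ q, q ∉ I → 0 ≤ d0 q := fun q hq =>
    ge_of_tendsto (hfin q hq) (Eventually.of_forall fun t => h0 t q)
  refine ext_of_mulVec_single fun j => ?_
  set x : E → ℝ := Pi.single j 1
  set v := Y *ᵥ x - X *ᵥ x with hv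
  have hvI : ∀ q ∈ I, (Zᵀ *ᵥ v) q = 0 := fun q hq => by
    rw [hv, mulVec_sub, Pi.sub_apply, hP1 Y hY x q hq, hP1 X hX x q hq, sub_zero]
  have hYv := hP2 Y hY v hvI x
  have hXv := hP2 X hX v hvI x
  have key : ∑ q, (if q ∈ I then 0 else d0 q) * ((Zᵀ *ᵥ v) q * (Zᵀ *ᵥ v) q) +
      ∑ e, m e * (v e * v e) = 0 := by
    refine Eq.trans ?_ (sub_eq_zero.2 (hYv.trans hXv.symm))
    rw [add_sub_add_comm, ← Finset.sum_sub_distrib, ← Finset.sum_sub_distrib]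
    congr 1
    · refine Finset.sum_congr rfl fun q _ => ?_
      have : (Zᵀ *ᵥ v) q = (Zᵀ *ᵥ (Y *ᵥ x)) q - (Zᵀ *ᵥ (X *ᵥ x)) q := by
        rw [hv, mulVec_sub, Pi.sub_apply]
      nth_rewrite 2 [this]
      ring
    · refine Finset.sum_congr rfl fun e _ => ?_
      have : v e = (Y *ᵥ x) e - (X *ᵥ x) e := by rw [hv, Pi.sub_apply]
      nth_rewrite 2 [this]
      ring
  have k1 : 0 ≤ ∑ q, (if q ∈ I then 0 else d0 q) * ((Zᵀ *ᵥ v) q * (Zᵀ *ᵥ v) q) :=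
    Finset.sum_nonneg fun q _ => mul_nonneg (by split_ifs with h; exacts [le_rfl, hd0 q h])
      (mul_self_nonneg _)
  have k2 : ∑ e, m e * (v e * v e) = 0 := le_antisymm (by linarith) (he0 v)
  rw [Finset.sum_eq_zero_iff_of_nonneg
    fun e _ => mul_nonneg (hm e).le (mul_self_nonneg _)] at k2
  have hv0 : v = 0 := by
    ext e
    have := k2 e (Finset.mem_univ e)
    simpa [(hm e).ne'] using this
  exact sub_eq_zero.1 (hv ▸ hv0)

theorem dense_finite : Dense {l : ℝ≥0∞ × ℝ≥0∞ | l.1 ≠ ⊤ ∧ l.2 ≠ ⊤} :=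
  (dense_compl_singleton (⊤ : ℝ≥0∞)).prod (dense_compl_singleton (⊤ : ℝ≥0∞))

theorem exists_tendsto_sigmaMat_inv (K : Fin r → Fin c → ℕ) (l : ℝ≥0∞ × ℝ≥0∞) :
    ∃ X, Tendsto (fun l : ℝ≥0∞ × ℝ≥0∞ => (sigmaMat K l.1.toReal l.2.toReal)⁻¹)
      (𝓝[{l : ℝ≥0∞ × ℝ≥0∞ | l.1 ≠ ⊤ ∧ l.2 ≠ ⊤}] l) (𝓝 X) := by
  have hne : (𝓝[{l : ℝ≥0∞ × ℝ≥0∞ | l.1 ≠ ⊤ ∧ l.2 ≠ ⊤}] l).NeBot :=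
    mem_closure_iff_nhdsWithin_neBot.1 (dense_finite l)
  have hcoord : ∀ (f : ℝ≥0∞ × ℝ≥0∞ → ℝ≥0∞), Continuous f → ∀ {A : Set (ℝ≥0∞ × ℝ≥0∞)},
      (∀ p ∈ A, f p ≠ ⊤) → (f l = ⊤ → Tendsto (fun p => (f p).toReal) (𝓝[A] l) atTop) ∧
        (f l ≠ ⊤ → Tendsto (fun p => (f p).toReal) (𝓝[A] l) (𝓝 (f l).toReal)) := by
    intro f hf A hA
    have ht : Tendsto f (𝓝[A] l) (𝓝 (f l)) := (hf.tendsto l).mono_left nhdsWithin_le_nhds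
    refine ⟨fun h => ?_, fun h => (ENNReal.tendsto_toReal h).comp ht⟩
    rw [h] at ht
    refine tendsto_atTop.2 fun b => ?_
    filter_upwards [ht.eventually (lt_mem_nhds (ENNReal.ofReal_lt_top (r := b))),
      self_mem_nhdsWithin] with p hp hpA
    exact (ENNReal.ofReal_le_iff_le_toReal (hA p hpA)).1 hp.le
  obtain ⟨a1, a2⟩ := hcoord Prod.fst continuous_fst
    (A := {l : ℝ≥0∞ × ℝ≥0∞ | l.1 ≠ ⊤ ∧ l.2 ≠ ⊤}) (fun p hp => hp.1)
  obtain ⟨b1, b2⟩ := hcoord Prod.snd continuous_snd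
    (A := {l : ℝ≥0∞ × ℝ≥0∞ | l.1 ≠ ⊤ ∧ l.2 ≠ ⊤}) (fun p hp => hp.2)
  have key := exists_tendsto_inv (obsDesign K) (fun e : Obs K => ((K e.1.1 e.1.2 : ℕ) : ℝ)⁻¹)
    (fun e => inv_pos.2 (Nat.cast_pos.2 e.2)) (𝓝[{l : ℝ≥0∞ × ℝ≥0∞ | l.1 ≠ ⊤ ∧ l.2 ≠ ⊤}] l)
    (fun p : ℝ≥0∞ × ℝ≥0∞ => Sum.elim (fun _ => p.1.toReal) (fun _ => p.2.toReal)) ?_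
    {q | Sum.elim (fun _ => l.1) (fun _ => l.2) q = ⊤}
    (Sum.elim (fun _ => l.1.toReal) (fun _ => l.2.toReal)) ?_ ?_
  · exact key
  · rintro t (q | q) <;> exact ENNReal.toReal_nonneg
  · rintro (q | q) hq
    exacts [a1 hq, b1 hq]
  · rintro (q | q) hq
    exacts [a2 hq, b2 hq]

theorem tendsto_sigmaInv (K : Fin r → Fin c → ℕ) (l : ℝ≥0∞ × ℝ≥0∞) :
    Tendsto (fun l : ℝ≥0∞ × ℝ≥0∞ => (sigmaMat K l.1.toReal l.2.toReal)⁻¹)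
      (𝓝[{l : ℝ≥0∞ × ℝ≥0∞ | l.1 ≠ ⊤ ∧ l.2 ≠ ⊤}] l) (𝓝 (sigmaInv K l)) :=
  tendsto_extendFrom (exists_tendsto_sigmaMat_inv K l)

theorem continuous_sigmaInv (K : Fin r → Fin c → ℕ) : Continuous (sigmaInv K) :=
  have : RegularSpace (Matrix (Obs K) (Obs K) ℝ) :=
    inferInstanceAs (RegularSpace (Obs K → Obs K → ℝ))
  continuous_extendFrom dense_finite (exists_tendsto_sigmaMat_inv K)

/-- At finite hyper-parameters `sigmaInv` is the inverse of `sigmaMat`. -/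
theorem sigmaInv_of_ne_top (K : Fin r → Fin c → ℕ) {l : ℝ≥0∞ × ℝ≥0∞} (h1 : l.1 ≠ ⊤)
    (h2 : l.2 ≠ ⊤) : sigmaInv K l = (sigmaMat K l.1.toReal l.2.toReal)⁻¹ := by
  exact (tendsto_nhds_unique (tendsto_pure_nhds _ l)
    ((tendsto_sigmaInv K l).mono_left (pure_le_nhdsWithin ⟨h1, h2⟩))).symm

theorem hyperDomain_nonempty (K : Fin r → Fin c → ℕ) {τ : ℝ} (hτ : τ ∈ Set.Ioc (0 : ℝ) 1)
    (y : Obs K → ℝ) : (hyperDomain K τ y).Nonempty := by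
  refine ⟨(quantile y (τ / 2), 0, 0), ⟨⟨le_rfl, ?_⟩, Set.mem_univ _⟩⟩
  have hmono : ∀ x, (1 - τ / 2) * (Fintype.card (Obs K) : ℝ) ≤
      (({i | y i ≤ x} : Set (Obs K)).ncard : ℝ) →
      τ / 2 * (Fintype.card (Obs K) : ℝ) ≤ (({i | y i ≤ x} : Set (Obs K)).ncard : ℝ) :=
    fun x hx => (mul_le_mul_of_nonneg_right (by linarith [hτ.2]) (Nat.cast_nonneg _)).trans hx
  rcases isEmpty_or_nonempty (Obs K) with hE | hE
  · simp [quantile, Fintype.card_eq_zero]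
  refine csInf_le_csInf ?_ ?_ hmono
  · obtain ⟨b, hb⟩ := (Set.finite_range y).bddBelow
    refine ⟨b, fun x hx => ?_⟩
    by_contra! hlt
    have : ({i | y i ≤ x} : Set (Obs K)) = ∅ := by
      ext i
      simpa using hlt.trans_le (hb ⟨i, rfl⟩)
    rw [Set.mem_ofPred_eq, this, Set.ncard_empty, Nat.cast_zero] at hx
    have : 0 < τ / 2 * (Fintype.card (Obs K) : ℝ) :=
      mul_pos (by linarith [hτ.1]) (Nat.cast_pos.2 Fintype.card_pos)
    linarith
  · obtain ⟨b, hb⟩ := (Set.finite_range y).bddAbove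
    refine ⟨b, ?_⟩
    have : ({i | y i ≤ b} : Set (Obs K)) = Set.univ := by
      ext i
      simpa using hb ⟨i, rfl⟩
    rw [Set.mem_ofPred_eq, this, Set.ncard_univ, Nat.card_eq_fintype_card]
    have : (0 : ℝ) ≤ Fintype.card (Obs K) := Nat.cast_nonneg _
    nlinarith [hτ.1]

theorem isCompact_hyperDomain (K : Fin r → Fin c → ℕ) (τ : ℝ) (y : Obs K → ℝ) :
    IsCompact (hyperDomain K τ y) :=
  isCompact_Icc.prod isCompact_univ

theorem exists_isURETuning (K : Fin r → Fin c → ℕ) (σ : ℝ) {τ : ℝ}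
    (hτ : τ ∈ Set.Ioc (0 : ℝ) 1) (y : Obs K → ℝ) : ∃ h, IsURETuning K σ τ y h := by
  refine (isCompact_hyperDomain K τ y).exists_isMinOn (hyperDomain_nonempty K hτ y)
    (Continuous.continuousOn ?_)
  have h1 := (continuous_sigmaInv K).comp (continuous_snd (X := ℝ) (Y := ℝ≥0∞ × ℝ≥0∞))
  simp only [Function.comp_def] at h1
  unfold ure
  fun_prop

theorem exists_isOracleTuning (K : Fin r → Fin c → ℕ) {τ : ℝ} (hτ : τ ∈ Set.Ioc (0 : ℝ) 1)
    (η : Fin r × Fin c → ℝ) (y : Obs K → ℝ) : ∃ h, IsOracleTuning K τ η y h := by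
  refine (isCompact_hyperDomain K τ y).exists_isMinOn (hyperDomain_nonempty K hτ y)
    (Continuous.continuousOn ?_)
  have h1 := (continuous_sigmaInv K).comp (continuous_snd (X := ℝ) (Y := ℝ≥0∞ × ℝ≥0∞))
  simp only [Function.comp_def] at h1
  unfold loss cellEstimator shrink
  fun_prop

end TwoWay

open TwoWay

/-!
# Asymptotic optimality of the tuning by the unbiased risk estimate

Write `ε = y - η` for the errors, `S = Σ⁻¹`, `Λ` for the largest eigenvalue of `Q`, `ν` for the
imbalance, `𝓔` for the set of observed cells and `N = r c`. Estimability gives `Z_c Z† Z = Z_c`,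
so that `Z_c Z†` recovers all cell means from the observed ones, and the loss minus its unbiased
estimate is a quantity free of the hyper-parameters minus twice

  `fluctuation = N⁻¹ (εᵀ Q M S (y - μ 1) - σ² tr (S M Q M))`

(`loss_sub_ure`). Hence the excess loss is at most four times the supremum of `|fluctuation|` over
the domain of the hyper-parameters (`loss_sub_loss_le`), which has to tend to `0` in probability.

For fixed variance components, `fluctuation` splits into a centered quadratic form in `ε`, a
linear form with coefficients from `η`, and `μ` times a linear form. As `M S` is a contraction for
the norm weighted by `M⁻¹`, the standard deviations of these are `O(√(Λ² ν / N))`. The location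
`μ` lies between two empirical quantiles, so `μ² |𝓔| = O(‖y‖²)` (`sq_mul_card_le_of_mem_quantile`)
and `μ` factors out.

Uniformity in `(λ_A, λ_B)` comes from a net (`exists_net`). By the resolvent identity, a change of
`λ_A` alters the bilinear form of `S` by `(λ_A' - λ_A) ⟨Z_Aᵀ S v, Z_Aᵀ S' x⟩`. There are two
bounds for the norm of `Z_Aᵀ S x`: a trivial one for small `λ_A`, and one of order `1 / λ_A`,
since the predicted effects `λ_A Z_Aᵀ S x` are controlled by the fitted values in all cells, and
these, up to the factor `Λ`, by the fitted values in the observed cells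
(`sum_predicted_effects_sq_le`). Together they make `S` Lipschitz, with constant of order
`√(Λ ν)`, in a variable `t ∈ [0, 1)` that replaces `λ_A ∈ [0, ∞)`. A grid of `n²` points then has
mesh of order `√(Λ ν) / n` in operator norm. The net error `Λ √ν √(Λ ν) / n` and the union bound
`n² Λ² ν / N` obtained from Chebyshev's inequality both vanish for `n ≈ N ^ (1 / 4)`, because
`Λ ν = o(N ^ (1 / 8))` (`mesh_bounds`). Infinite variance components are reached by continuity
(`sigmaInv_induction`).
-/

namespace TwoWay

/-! ### Perturbation of the inverse covariance -/

section Inverse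

variable {E J : Type*} [Fintype E] [Fintype J] [DecidableEq E] [DecidableEq J]

theorem posDef_sigma (Z : Matrix E J ℝ) {m : E → ℝ} (hm : ∀ e, 0 < m e) {d : J → ℝ}
    (hd : ∀ q, 0 ≤ d q) : (Z * diagonal d * Zᵀ + diagonal m).PosDef := by
  have h1 : (Z * diagonal d * Zᵀ).PosSemidef := by
    simpa using (PosSemidef.diagonal hd).mul_mul_conjTranspose_same Z
  exact PosDef.posSemidef_add h1 (PosDef.diagonal hm)

theorem sigma_mulVec_inv_mulVec (Z : Matrix E J ℝ) {m : E → ℝ} (hm : ∀ e, 0 < m e) {d : J → ℝ}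
    (hd : ∀ q, 0 ≤ d q) (x : E → ℝ) :
    (Z * diagonal d * Zᵀ + diagonal m) *ᵥ ((Z * diagonal d * Zᵀ + diagonal m)⁻¹ *ᵥ x) = x := by
  rw [mulVec_mulVec, mul_nonsing_inv _
    ((isUnit_iff_isUnit_det _).1 (posDef_sigma Z hm hd).isUnit), one_mulVec]

theorem transpose_sigma_inv (Z : Matrix E J ℝ) {m : E → ℝ} (hm : ∀ e, 0 < m e) {d : J → ℝ}
    (hd : ∀ q, 0 ≤ d q) :
    ((Z * diagonal d * Zᵀ + diagonal m)⁻¹)ᵀ = (Z * diagonal d * Zᵀ + diagonal m)⁻¹ := by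
  rw [transpose_nonsing_inv]
  congr 1
  simpa using (posDef_sigma Z hm hd).isHermitian.eq

/-- `uᵀ M u ≤ uᵀ Σ u = uᵀ x` for `u = Σ⁻¹ x`. -/
theorem sum_le_inv_mulVec_dotProduct (Z : Matrix E J ℝ) {m : E → ℝ} (hm : ∀ e, 0 < m e)
    {d : J → ℝ} (hd : ∀ q, 0 ≤ d q) (x : E → ℝ) :
    ∑ e, m e * ((Z * diagonal d * Zᵀ + diagonal m)⁻¹ *ᵥ x) e ^ 2 ≤
      ((Z * diagonal d * Zᵀ + diagonal m)⁻¹ *ᵥ x) ⬝ᵥ x := by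
  have h := dotProduct_sigma_mulVec Z m d ((Z * diagonal d * Zᵀ + diagonal m)⁻¹ *ᵥ x)
    ((Z * diagonal d * Zᵀ + diagonal m)⁻¹ *ᵥ x)
  rw [sigma_mulVec_inv_mulVec Z hm hd] at h
  rw [h]
  simp only [← sq]
  have := Finset.sum_nonneg fun q (_ : q ∈ Finset.univ) => mul_nonneg (hd q)
    (sq_nonneg ((Zᵀ *ᵥ ((Z * diagonal d * Zᵀ + diagonal m)⁻¹ *ᵥ x)) q))
  linarith

/-- In the norm weighted by `M⁻¹`, the map `M Σ⁻¹` is a contraction. -/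
theorem sum_inv_mulVec_sq_le (Z : Matrix E J ℝ) {m : E → ℝ} (hm : ∀ e, 0 < m e) {d : J → ℝ}
    (hd : ∀ q, 0 ≤ d q) (x : E → ℝ) :
    ∑ e, m e * ((Z * diagonal d * Zᵀ + diagonal m)⁻¹ *ᵥ x) e ^ 2 ≤ ∑ e, (m e)⁻¹ * x e ^ 2 := by
  have h1 := sum_le_inv_mulVec_dotProduct Z hm hd x
  set u := (Z * diagonal d * Zᵀ + diagonal m)⁻¹ *ᵥ x
  have h2 : u ⬝ᵥ x ≤ ∑ e, (m e * u e ^ 2 + (m e)⁻¹ * x e ^ 2) / 2 := by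
    refine Finset.sum_le_sum fun e _ => ?_
    have h := mul_nonneg (hm e).le (sq_nonneg (u e - (m e)⁻¹ * x e))
    have : m e * (u e - (m e)⁻¹ * x e) ^ 2 =
        m e * u e ^ 2 + (m e)⁻¹ * x e ^ 2 - 2 * (u e * x e) := by
      have := (hm e).ne'
      field_simp
      ring
    linarith
  rw [← Finset.sum_div, Finset.sum_add_distrib] at h2
  linarith

/-- In the norm weighted by `M⁻¹`, the map `1 - M Σ⁻¹` is a contraction. -/
theorem sum_design_mulVec_sq_le (Z : Matrix E J ℝ) {m : E → ℝ} (hm : ∀ e, 0 < m e) {d : J → ℝ}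
    (hd : ∀ q, 0 ≤ d q) (x : E → ℝ) :
    ∑ e, (m e)⁻¹ * (Z *ᵥ fun q => d q *
      (Zᵀ *ᵥ ((Z * diagonal d * Zᵀ + diagonal m)⁻¹ *ᵥ x)) q) e ^ 2 ≤
        ∑ e, (m e)⁻¹ * x e ^ 2 := by
  have h1 := sum_le_inv_mulVec_dotProduct Z hm hd x
  have h2 := sigma_mulVec_inv_mulVec Z hm hd x
  set u := (Z * diagonal d * Zᵀ + diagonal m)⁻¹ *ᵥ x
  have h3 : ∀ e, (Z *ᵥ fun q => d q * (Zᵀ *ᵥ u) q) e = x e - m e * u e := by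
    intro e
    rw [add_mulVec, ← mulVec_mulVec, ← mulVec_mulVec] at h2
    have h4 := congrFun h2 e
    have h5 : (diagonal d *ᵥ (Zᵀ *ᵥ u)) = fun q => d q * (Zᵀ *ᵥ u) q := by
      ext q
      simp [mulVec_diagonal]
    rw [h5, Pi.add_apply, mulVec_diagonal] at h4
    linarith
  have h4 : ∑ e, (m e)⁻¹ * (x e - m e * u e) ^ 2 =
      ∑ e, (m e)⁻¹ * x e ^ 2 - 2 * (u ⬝ᵥ x) + ∑ e, m e * u e ^ 2 := by
    rw [dotProduct, Finset.mul_sum, ← Finset.sum_sub_distrib, ← Finset.sum_add_distrib]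
    refine Finset.sum_congr rfl fun e _ => ?_
    have := (hm e).ne'
    field_simp
    ring
  have h0 : 0 ≤ ∑ e, m e * u e ^ 2 :=
    Finset.sum_nonneg fun e _ => mul_nonneg (hm e).le (sq_nonneg _)
  simp only [h3]
  rw [h4]
  linarith

/-- The resolvent identity `Σ⁻¹ - Σ'⁻¹ = Σ⁻¹ (Σ' - Σ) Σ'⁻¹` as an identity of bilinear forms. -/
theorem dotProduct_sigma_inv_sub (Z : Matrix E J ℝ) {m : E → ℝ} (hm : ∀ e, 0 < m e)
    {d d' : J → ℝ} (hd : ∀ q, 0 ≤ d q) (hd' : ∀ q, 0 ≤ d' q) (v x : E → ℝ) :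
    v ⬝ᵥ ((Z * diagonal d * Zᵀ + diagonal m)⁻¹ *ᵥ x) -
        v ⬝ᵥ ((Z * diagonal d' * Zᵀ + diagonal m)⁻¹ *ᵥ x) =
      ∑ q, (d' q - d q) * ((Zᵀ *ᵥ ((Z * diagonal d * Zᵀ + diagonal m)⁻¹ *ᵥ v)) q *
        (Zᵀ *ᵥ ((Z * diagonal d' * Zᵀ + diagonal m)⁻¹ *ᵥ x)) q) := by
  have a := dotProduct_sigma_mulVec Z m d ((Z * diagonal d * Zᵀ + diagonal m)⁻¹ *ᵥ v)
    ((Z * diagonal d' * Zᵀ + diagonal m)⁻¹ *ᵥ x)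
  have b := dotProduct_sigma_mulVec Z m d' ((Z * diagonal d * Zᵀ + diagonal m)⁻¹ *ᵥ v)
    ((Z * diagonal d' * Zᵀ + diagonal m)⁻¹ *ᵥ x)
  rw [sigma_mulVec_inv_mulVec Z hm hd'] at b
  have hs : ∀ y : E → ℝ, ((Z * diagonal d * Zᵀ + diagonal m)⁻¹ *ᵥ v) ⬝ᵥ y =
      v ⬝ᵥ ((Z * diagonal d * Zᵀ + diagonal m)⁻¹ *ᵥ y) := fun y => by
    rw [dotProduct_mulVec, ← mulVec_transpose, transpose_sigma_inv Z hm hd]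
  have hs' : (Z * diagonal d * Zᵀ + diagonal m)⁻¹ *ᵥ ((Z * diagonal d * Zᵀ + diagonal m) *ᵥ
      ((Z * diagonal d' * Zᵀ + diagonal m)⁻¹ *ᵥ x)) =
        (Z * diagonal d' * Zᵀ + diagonal m)⁻¹ *ᵥ x := by
    rw [mulVec_mulVec, nonsing_inv_mul _
      ((isUnit_iff_isUnit_det _).1 (posDef_sigma Z hm hd).isUnit), one_mulVec]
  rw [hs, hs'] at a
  rw [hs] at b
  rw [a, b, add_sub_add_right_eq_sub, ← Finset.sum_sub_distrib]
  exact Finset.sum_congr rfl fun q _ => by ring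

end Inverse

/-! ### The extrapolation matrix -/

open scoped MatrixOrder in
theorem dotProduct_mulVec_le_lambdaMax {n : Type*} [Fintype n] [DecidableEq n]
    {A : Matrix n n ℝ} (hA : A.IsHermitian) (x : n → ℝ) :
    x ⬝ᵥ (A *ᵥ x) ≤ lambdaMax A * (x ⬝ᵥ x) := by
  have h1 : A ≤ algebraMap ℝ _ (lambdaMax A) :=
    le_algebraMap_of_spectrum_le
      (fun t ht => le_csSup Matrix.finite_real_spectrum.bddAbove ht) hA.isSelfAdjoint
  have h2 := (Matrix.le_iff.1 h1).dotProduct_mulVec_nonneg x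
  rw [sub_mulVec, Algebra.algebraMap_eq_smul_one, smul_mulVec, one_mulVec, dotProduct_sub,
    dotProduct_smul, star_trivial, smul_eq_mul] at h2
  linarith

section Extrapolation

variable {r c : ℕ} {K : Fin r → Fin c → ℕ}

theorem extrapolate_mul_obsDesign (hK : Estimable K) :
    extrapolate K * obsDesign K = fullDesign r c := by
  have hle : LinearMap.ker (fullDesign r c).mulVecLin ≤ LinearMap.ker (obsDesign K).mulVecLin := by
    intro w hw
    rw [LinearMap.mem_ker, mulVecLin_apply] at hw ⊢
    ext e
    exact congrFun hw e.1
  have hker : LinearMap.ker (fullDesign r c).mulVecLin = LinearMap.ker (obsDesign K).mulVecLin := by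
    refine Submodule.eq_of_le_of_finrank_eq hle ?_
    have h1 := (fullDesign r c).mulVecLin.finrank_range_add_finrank_ker
    have h2 := (obsDesign K).mulVecLin.finrank_range_add_finrank_ker
    have h3 : (obsDesign K).rank = (fullDesign r c).rank := hK
    simp only [Matrix.rank] at h3
    omega
  refine ext_of_mulVec_single fun j => ?_
  have hp := (pinv_spec (obsDesign K)).1
  have hmem : pinv (obsDesign K) *ᵥ (obsDesign K *ᵥ Pi.single j 1) - Pi.single j 1 ∈
      LinearMap.ker (fullDesign r c).mulVecLin := by
    rw [hker, LinearMap.mem_ker, mulVecLin_apply, mulVec_sub, mulVec_mulVec, mulVec_mulVec, hp,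
      sub_self]
  rw [LinearMap.mem_ker, mulVecLin_apply, mulVec_sub, sub_eq_zero] at hmem
  rw [extrapolate, ← mulVec_mulVec, ← mulVec_mulVec, hmem]

theorem dotProduct_lossQ_mulVec (K : Fin r → Fin c → ℕ) (x y : Obs K → ℝ) :
    x ⬝ᵥ (lossQ K *ᵥ y) = (extrapolate K *ᵥ x) ⬝ᵥ (extrapolate K *ᵥ y) := by
  rw [lossQ, ← mulVec_mulVec, dotProduct_mulVec x, vecMul_transpose]

theorem transpose_lossQ (K : Fin r → Fin c → ℕ) : (lossQ K)ᵀ = lossQ K := by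
  rw [lossQ, transpose_mul, transpose_transpose]

theorem extrapolate_sq_le (K : Fin r → Fin c → ℕ) (x : Obs K → ℝ) :
    ∑ p, (extrapolate K *ᵥ x) p ^ 2 ≤ lambdaMax (lossQ K) * ∑ e, x e ^ 2 := by
  have h := dotProduct_mulVec_le_lambdaMax (A := lossQ K)
    (by rw [IsHermitian, conjTranspose_eq_transpose_of_trivial, transpose_lossQ]) x
  rw [dotProduct_lossQ_mulVec] at h
  simpa [dotProduct, sq] using h

theorem fullDesign_sq_le (hK : Estimable K) (w : Fin r ⊕ Fin c → ℝ) :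
    ∑ p, (fullDesign r c *ᵥ w) p ^ 2 ≤
      lambdaMax (lossQ K) * ∑ e, (obsDesign K *ᵥ w) e ^ 2 := by
  have h := extrapolate_sq_le K (obsDesign K *ᵥ w)
  rwa [mulVec_mulVec, extrapolate_mul_obsDesign hK] at h

theorem lossQ_sq_le (K : Fin r → Fin c → ℕ) (x : Obs K → ℝ) :
    ∑ e, (lossQ K *ᵥ x) e ^ 2 ≤ lambdaMax (lossQ K) ^ 2 * ∑ e, x e ^ 2 := by
  set z := lossQ K *ᵥ x with hz
  have h1 : (∑ e, z e ^ 2) ^ 2 ≤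
      (∑ p, (extrapolate K *ᵥ z) p ^ 2) * ∑ p, (extrapolate K *ᵥ x) p ^ 2 := by
    have : ∑ e, z e ^ 2 = ∑ p, (extrapolate K *ᵥ z) p * (extrapolate K *ᵥ x) p := by
      have := dotProduct_lossQ_mulVec K z x
      rw [← hz] at this
      simpa [dotProduct, sq] using this
    rw [this]
    exact Finset.sum_mul_sq_le_sq_mul_sq _ _ _
  have hz0 : 0 ≤ ∑ e, z e ^ 2 := Finset.sum_nonneg fun _ _ => sq_nonneg _
  rcases hz0.eq_or_lt with h0 | h0
  · rw [← h0]
    exact mul_nonneg (sq_nonneg _) (Finset.sum_nonneg fun _ _ => sq_nonneg _)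
  have h2 := mul_le_mul (extrapolate_sq_le K z) (extrapolate_sq_le K x)
    (Finset.sum_nonneg fun _ _ => sq_nonneg _)
    ((Finset.sum_nonneg fun _ _ => sq_nonneg _).trans (extrapolate_sq_le K z))
  refine le_of_mul_le_mul_left ?_ h0
  calc _ = (∑ e, z e ^ 2) ^ 2 := by ring
    _ ≤ _ := h1.trans h2
    _ = _ := by ring

theorem exists_fullDesign_mulVec_sq_pos (hr : 0 < r) (hc : 0 < c) :
    ∃ w, 0 < ∑ p, (fullDesign r c *ᵥ w) p ^ 2 := by
  refine ⟨Pi.single (Sum.inl ⟨0, hr⟩) 1, Finset.sum_pos' (fun _ _ => sq_nonneg _)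
    ⟨(⟨0, hr⟩, ⟨0, hc⟩), Finset.mem_univ _, ?_⟩⟩
  simp [fullDesign]

theorem nonempty_obs (hK : Estimable K) (hr : 0 < r) (hc : 0 < c) : Nonempty (Obs K) := by
  by_contra h
  rw [not_nonempty_iff] at h
  obtain ⟨w, hw⟩ := exists_fullDesign_mulVec_sq_pos hr hc
  have := fullDesign_sq_le hK w
  simp only [Finset.univ_eq_empty, Finset.sum_empty, mul_zero] at this
  linarith

theorem sum_obs_le (K : Fin r → Fin c → ℕ) {f : Fin r × Fin c → ℝ} (hf : ∀ p, 0 ≤ f p) :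
    ∑ e : Obs K, f e.1 ≤ ∑ p, f p := by
  calc ∑ e : Obs K, f e.1
      = ∑ p ∈ Finset.univ.map (Function.Embedding.subtype fun p => 0 < K p.1 p.2), f p := by
        simp
    _ ≤ ∑ p, f p := Finset.sum_le_univ_sum_of_nonneg hf

theorem one_le_lambdaMax_lossQ (hK : Estimable K) (hr : 0 < r) (hc : 0 < c) :
    1 ≤ lambdaMax (lossQ K) := by
  obtain ⟨w, hw⟩ := exists_fullDesign_mulVec_sq_pos hr hc
  have h1 := fullDesign_sq_le hK w
  have h2 : ∑ e, (obsDesign K *ᵥ w) e ^ 2 ≤ ∑ p, (fullDesign r c *ᵥ w) p ^ 2 :=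
    sum_obs_le K (f := fun p => (fullDesign r c *ᵥ w) p ^ 2) fun _ => sq_nonneg _
  have h3 : 0 ≤ ∑ e, (obsDesign K *ᵥ w) e ^ 2 := Finset.sum_nonneg fun _ _ => sq_nonneg _
  by_contra! h
  rcases h3.eq_or_lt with h0 | h0
  · rw [← h0] at h1; linarith
  · nlinarith

theorem card_obs_le (K : Fin r → Fin c → ℕ) : (Fintype.card (Obs K) : ℝ) ≤ r * c := by
  have := sum_obs_le K (f := fun _ => 1) fun _ => zero_le_one
  simpa using this

end Extrapolation

/-! ### A finite net for the variance components -/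

section Net

variable {r c : ℕ} {K : Fin r → Fin c → ℕ}

/-- The squared norm weighted by `M⁻¹`, that is by the cell counts. -/
def weightedSq (K : Fin r → Fin c → ℕ) (x : Obs K → ℝ) : ℝ :=
  ∑ e, (K e.1.1 e.1.2 : ℝ) * x e ^ 2

theorem weightedSq_nonneg (x : Obs K → ℝ) : 0 ≤ weightedSq K x :=
  Finset.sum_nonneg fun _ _ => mul_nonneg (Nat.cast_nonneg _) (sq_nonneg _)

theorem sum_fiber_sq_le {E ι : Type*} [Fintype E] [Fintype ι] [DecidableEq ι] (φ : E → ι) {n : ℕ}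
    (hn : ∀ i, (Finset.univ.filter (φ · = i)).card ≤ n) (u : E → ℝ) :
    ∑ i, (∑ e, if φ e = i then u e else 0) ^ 2 ≤ n * ∑ e, u e ^ 2 := by
  calc ∑ i, (∑ e, if φ e = i then u e else 0) ^ 2
      ≤ ∑ i, (n : ℝ) * ∑ e with φ e = i, u e ^ 2 := by
        refine Finset.sum_le_sum fun i _ => ?_
        rw [← Finset.sum_filter]
        refine sq_sum_le_card_mul_sum_sq.trans ?_
        exact mul_le_mul_of_nonneg_right (by exact_mod_cast hn i)
          (Finset.sum_nonneg fun _ _ => sq_nonneg _)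
    _ = n * ∑ e, u e ^ 2 := by
        rw [← Finset.mul_sum, Finset.sum_fiberwise]

theorem obsDesign_transpose_mulVec_inl (K : Fin r → Fin c → ℕ) (u : Obs K → ℝ) (i : Fin r) :
    ((obsDesign K)ᵀ *ᵥ u) (Sum.inl i) = ∑ e : Obs K, if e.1.1 = i then u e else 0 := by
  simp [mulVec, dotProduct, obsDesign, fullDesign]

theorem obsDesign_transpose_mulVec_inr (K : Fin r → Fin c → ℕ) (u : Obs K → ℝ) (j : Fin c) :
    ((obsDesign K)ᵀ *ᵥ u) (Sum.inr j) = ∑ e : Obs K, if e.1.2 = j then u e else 0 := by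
  simp [mulVec, dotProduct, obsDesign, fullDesign]

theorem card_filter_row_le (K : Fin r → Fin c → ℕ) (i : Fin r) :
    (Finset.univ.filter fun e : Obs K => e.1.1 = i).card ≤ c := by
  refine (Finset.card_le_card_of_injOn (t := Finset.univ) (fun e : Obs K => e.1.2)
    (fun _ _ => Finset.mem_coe.2 (Finset.mem_univ _)) ?_).trans_eq (by simp)
  intro e he e' he' h
  simp only [Finset.coe_filter, Finset.mem_univ, true_and, Set.mem_ofPred_eq] at he he'
  exact Subtype.ext (Prod.ext (he.trans he'.symm) h)

theorem card_filter_col_le (K : Fin r → Fin c → ℕ) (j : Fin c) :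
    (Finset.univ.filter fun e : Obs K => e.1.2 = j).card ≤ r := by
  refine (Finset.card_le_card_of_injOn (t := Finset.univ) (fun e : Obs K => e.1.1)
    (fun _ _ => Finset.mem_coe.2 (Finset.mem_univ _)) ?_).trans_eq (by simp)
  intro e he e' he' h
  simp only [Finset.coe_filter, Finset.mem_univ, true_and, Set.mem_ofPred_eq] at he he'
  exact Subtype.ext (Prod.ext h (he.trans he'.symm))

theorem cell_inv_pos (K : Fin r → Fin c → ℕ) (e : Obs K) :
    (0 : ℝ) < ((K e.1.1 e.1.2 : ℕ) : ℝ)⁻¹ :=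
  inv_pos.2 (Nat.cast_pos.2 e.2)

theorem elim_nonneg {lA lB : ℝ} (hA : 0 ≤ lA) (hB : 0 ≤ lB) (q : Fin r ⊕ Fin c) :
    0 ≤ (Sum.elim (fun _ => lA) (fun _ => lB) : Fin r ⊕ Fin c → ℝ) q := by
  rcases q with q | q
  exacts [hA, hB]

theorem sum_sigmaMat_inv_mulVec_sq_le {lA lB : ℝ} (hA : 0 ≤ lA) (hB : 0 ≤ lB) (x : Obs K → ℝ) :
    ∑ e : Obs K, ((K e.1.1 e.1.2 : ℕ) : ℝ)⁻¹ * ((sigmaMat K lA lB)⁻¹ *ᵥ x) e ^ 2 ≤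
      weightedSq K x := by
  have h := sum_inv_mulVec_sq_le (obsDesign K) (cell_inv_pos K) (elim_nonneg hA hB) x
  simp only [inv_inv] at h
  exact h

theorem sum_sq_sigmaMat_inv_mulVec_le {k2 : ℝ} (h2 : ∀ e : Obs K, (K e.1.1 e.1.2 : ℝ) ≤ k2)
    {lA lB : ℝ} (hA : 0 ≤ lA) (hB : 0 ≤ lB) (x : Obs K → ℝ) :
    ∑ e, ((sigmaMat K lA lB)⁻¹ *ᵥ x) e ^ 2 ≤ k2 * weightedSq K x := by
  rcases isEmpty_or_nonempty (Obs K) with hE | ⟨⟨e0⟩⟩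
  · simp [weightedSq]
  have hk2 : 0 < k2 := (Nat.cast_pos.2 e0.2).trans_le (h2 e0)
  refine le_trans ?_ (mul_le_mul_of_nonneg_left (sum_sigmaMat_inv_mulVec_sq_le hA hB x) hk2.le)
  rw [Finset.mul_sum]
  refine Finset.sum_le_sum fun e _ => ?_
  rw [← mul_assoc]
  refine le_mul_of_one_le_left (sq_nonneg _) ?_
  rw [← div_eq_mul_inv, one_le_div (Nat.cast_pos.2 e.2)]
  exact h2 e

theorem sum_row_sq_le {k2 : ℝ} (h2 : ∀ e : Obs K, (K e.1.1 e.1.2 : ℝ) ≤ k2)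
    {lA lB : ℝ} (hA : 0 ≤ lA) (hB : 0 ≤ lB) (x : Obs K → ℝ) :
    ∑ i, ((obsDesign K)ᵀ *ᵥ ((sigmaMat K lA lB)⁻¹ *ᵥ x)) (Sum.inl i) ^ 2 ≤
      c * k2 * weightedSq K x := by
  simp only [obsDesign_transpose_mulVec_inl]
  refine (sum_fiber_sq_le (fun e : Obs K => e.1.1) (card_filter_row_le K) _).trans ?_
  rw [mul_assoc]
  exact mul_le_mul_of_nonneg_left (sum_sq_sigmaMat_inv_mulVec_le h2 hA hB x) (Nat.cast_nonneg _)

theorem sum_col_sq_le {k2 : ℝ} (h2 : ∀ e : Obs K, (K e.1.1 e.1.2 : ℝ) ≤ k2)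
    {lA lB : ℝ} (hA : 0 ≤ lA) (hB : 0 ≤ lB) (x : Obs K → ℝ) :
    ∑ j, ((obsDesign K)ᵀ *ᵥ ((sigmaMat K lA lB)⁻¹ *ᵥ x)) (Sum.inr j) ^ 2 ≤
      r * k2 * weightedSq K x := by
  simp only [obsDesign_transpose_mulVec_inr]
  refine (sum_fiber_sq_le (fun e : Obs K => e.1.2) (card_filter_col_le K) _).trans ?_
  rw [mul_assoc]
  exact mul_le_mul_of_nonneg_left (sum_sq_sigmaMat_inv_mulVec_le h2 hA hB x) (Nat.cast_nonneg _)

theorem sum_prod_add_sq (a : Fin r → ℝ) (b : Fin c → ℝ) :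
    ∑ p : Fin r × Fin c, (a p.1 + b p.2) ^ 2 =
      c * ∑ i, a i ^ 2 + r * ∑ j, b j ^ 2 + 2 * ((∑ i, a i) * ∑ j, b j) := by
  simp only [add_sq, Finset.sum_add_distrib, Fintype.sum_prod_type, Finset.sum_const,
    Finset.card_univ, Fintype.card_fin, nsmul_eq_mul, ← Finset.mul_sum, ← Finset.sum_mul]
  ring

/-- The effects `a = λ_A Z_Aᵀ Σ⁻¹ x` and `b = λ_B Z_Bᵀ Σ⁻¹ x` predicted from `x` are bounded
uniformly in the variance components. Their totals have the same sign, so the cross term in the sum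
of all `(a i + b j) ^ 2` helps, and that sum is controlled by the one over the observed cells. -/
theorem sum_predicted_effects_sq_le (hK : Estimable K) {k1 : ℝ} (hk1 : 0 < k1)
    (h1 : ∀ e : Obs K, k1 ≤ K e.1.1 e.1.2) (hΛ : 0 ≤ lambdaMax (lossQ K))
    {lA lB : ℝ} (hA : 0 ≤ lA) (hB : 0 ≤ lB) (x : Obs K → ℝ) :
    c * (lA ^ 2 * ∑ i, ((obsDesign K)ᵀ *ᵥ ((sigmaMat K lA lB)⁻¹ *ᵥ x)) (Sum.inl i) ^ 2) +
      r * (lB ^ 2 * ∑ j, ((obsDesign K)ᵀ *ᵥ ((sigmaMat K lA lB)⁻¹ *ᵥ x)) (Sum.inr j) ^ 2) ≤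
        lambdaMax (lossQ K) / k1 * weightedSq K x := by
  have h := sum_design_mulVec_sq_le (obsDesign K) (cell_inv_pos K) (elim_nonneg hA hB) x
  simp only [inv_inv] at h
  change ∑ e : Obs K, (K e.1.1 e.1.2 : ℝ) * (obsDesign K *ᵥ fun q =>
    (Sum.elim (fun _ => lA) (fun _ => lB) : Fin r ⊕ Fin c → ℝ) q *
      ((obsDesign K)ᵀ *ᵥ ((sigmaMat K lA lB)⁻¹ *ᵥ x)) q) e ^ 2 ≤ weightedSq K x at h
  set u := (sigmaMat K lA lB)⁻¹ *ᵥ x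
  set w : Fin r ⊕ Fin c → ℝ := fun q =>
    (Sum.elim (fun _ => lA) (fun _ => lB) : Fin r ⊕ Fin c → ℝ) q * ((obsDesign K)ᵀ *ᵥ u) q with hw
  have e1 : k1 * ∑ e, (obsDesign K *ᵥ w) e ^ 2 ≤ weightedSq K x := by
    refine le_trans ?_ h
    rw [Finset.mul_sum]
    exact Finset.sum_le_sum fun e _ => mul_le_mul_of_nonneg_right (h1 e) (sq_nonneg _)
  have e2 : ∑ p, (fullDesign r c *ᵥ w) p ^ 2 =
      ∑ p : Fin r × Fin c, (w (Sum.inl p.1) + w (Sum.inr p.2)) ^ 2 := by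
    refine Finset.sum_congr rfl fun p _ => ?_
    simp [fullDesign, mulVec, dotProduct]
  have e3 : ∑ i, w (Sum.inl i) = lA * ∑ e, u e := by
    simp only [hw, Sum.elim_inl, obsDesign_transpose_mulVec_inl]
    rw [← Finset.mul_sum, Finset.sum_comm]
    simp
  have e4 : ∑ j, w (Sum.inr j) = lB * ∑ e, u e := by
    simp only [hw, Sum.elim_inr, obsDesign_transpose_mulVec_inr]
    rw [← Finset.mul_sum, Finset.sum_comm]
    simp
  have e5 := fullDesign_sq_le hK w
  rw [e2, sum_prod_add_sq (fun i => w (Sum.inl i)) fun j => w (Sum.inr j), e3, e4] at e5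
  have e6 : ∑ i, w (Sum.inl i) ^ 2 = lA ^ 2 * ∑ i, ((obsDesign K)ᵀ *ᵥ u) (Sum.inl i) ^ 2 := by
    simp [hw, Finset.mul_sum, mul_pow]
  have e7 : ∑ j, w (Sum.inr j) ^ 2 = lB ^ 2 * ∑ j, ((obsDesign K)ᵀ *ᵥ u) (Sum.inr j) ^ 2 := by
    simp [hw, Finset.mul_sum, mul_pow]
  rw [e6, e7] at e5
  have e8 : 0 ≤ (lA * ∑ e, u e) * (lB * ∑ e, u e) := by
    have : (lA * ∑ e, u e) * (lB * ∑ e, u e) = (lA * lB) * (∑ e, u e) ^ 2 := by ring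
    rw [this]
    positivity
  have e9 : lambdaMax (lossQ K) * ∑ e, (obsDesign K *ᵥ w) e ^ 2 ≤
      lambdaMax (lossQ K) / k1 * weightedSq K x := by
    rw [div_mul_eq_mul_div, mul_div_assoc]
    refine mul_le_mul_of_nonneg_left ?_ hΛ
    rw [le_div_iff₀ hk1]
    linarith
  linarith

/-- Two bounds, by `a` and by `b / l`, are merged into one that is square integrable over
`l ∈ [0, ∞)`. -/
theorem sqrt_le_of_two_bounds {a b l p W : ℝ} (ha : 0 < a) (hb : 0 < b) (hl : 0 ≤ l)
    (h1 : p ≤ a ^ 2 * W) (h2 : l ^ 2 * p ≤ b ^ 2 * W) :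
    √p ≤ 2 * (a * b) / (b + a * l) * √W := by
  have e1 : √p ≤ a * √W := by
    have := Real.sqrt_le_sqrt h1
    rwa [Real.sqrt_mul (sq_nonneg a), Real.sqrt_sq ha.le] at this
  have e2 : l * √p ≤ b * √W := by
    have := Real.sqrt_le_sqrt h2
    rwa [Real.sqrt_mul (sq_nonneg l), Real.sqrt_sq hl, Real.sqrt_mul (sq_nonneg b),
      Real.sqrt_sq hb.le] at this
  have hpos : 0 < b + a * l := by positivity
  rw [div_mul_eq_mul_div, le_div_iff₀ hpos]
  nlinarith [mul_le_mul_of_nonneg_left e1 hb.le, mul_le_mul_of_nonneg_left e2 ha.le]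

/-- The change of variable `t = a l / (b + a l)` maps `[0, ∞)` into `[0, 1)`; the grid consists of
the points where `t` is a multiple of `1 / n`. -/
theorem exists_grid {a b : ℝ} (ha : 0 < a) (hb : 0 < b) {n : ℕ} (hn : 0 < n) :
    ∃ g : Fin n → ℝ, (∀ k, 0 ≤ g k) ∧ ∀ l, 0 ≤ l → ∃ k,
      (a * b) * |l - g k| / ((b + a * l) * (b + a * g k)) ≤ 1 / n := by
  have hn' : (0 : ℝ) < n := Nat.cast_pos.2 hn
  have hlt : ∀ k : Fin n, (k : ℝ) < n := fun k => Nat.cast_lt.2 k.2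
  refine ⟨fun k => b * k / (a * (n - k)), fun k => ?_, fun l hl => ?_⟩
  · have := sub_pos.2 (hlt k)
    positivity
  have hpos : 0 < b + a * l := by positivity
  set t := a * l / (b + a * l) with ht
  have ht0 : 0 ≤ t := by positivity
  have ht1 : t < 1 := by rw [ht, div_lt_one hpos]; linarith
  have hfl : ⌊(n : ℝ) * t⌋₊ < n := by
    rw [Nat.floor_lt (by positivity)]
    nlinarith
  refine ⟨⟨⌊(n : ℝ) * t⌋₊, hfl⟩, ?_⟩
  set k : ℝ := (⌊(n : ℝ) * t⌋₊ : ℝ) with hk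
  have k1 : k ≤ n * t := Nat.floor_le (by positivity)
  have k2 : (n : ℝ) * t < k + 1 := Nat.lt_floor_add_one _
  have k0 : 0 ≤ k := Nat.cast_nonneg _
  have hkn : 0 < (n : ℝ) - k := sub_pos.2 (Nat.cast_lt.2 hfl)
  change (a * b) * |l - b * k / (a * (n - k))| /
    ((b + a * l) * (b + a * (b * k / (a * (n - k))))) ≤ 1 / n
  have hgpos : 0 < b + a * (b * k / (a * (n - k))) := by positivity
  have e1 : (a * b) * |l - b * k / (a * (n - k))| /
      ((b + a * l) * (b + a * (b * k / (a * (n - k))))) = |t - k / n| := by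
    rw [← abs_of_pos (mul_pos hpos hgpos), ← abs_of_pos (mul_pos ha hb), ← abs_mul, ← abs_div]
    congr 1
    rw [ht]
    have := hkn.ne'
    have := hn'.ne'
    have := ha.ne'
    have := hb.ne'
    have := hpos.ne'
    have e2 : b + a * (b * k / (a * (n - k))) = b * n / (n - k) := by
      field_simp
      ring
    rw [e2]
    field_simp
    ring
  rw [e1, abs_of_nonneg (sub_nonneg.2 ((div_le_iff₀ hn').2 (by linarith)))]
  rw [sub_le_iff_le_add, ← add_div, le_div_iff₀ hn']
  linarith

/-- One block (rows or columns) of the resolvent identity, estimated with the change of variable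
of `exists_grid`. -/
theorem abs_sum_block_le {ι : Type*} [Fintype ι] {a b l l' δ V W : ℝ} (ha : 0 < a) (hb : 0 < b)
    (hl : 0 ≤ l) (hl' : 0 ≤ l') {f g : ι → ℝ}
    (hf1 : ∑ i, f i ^ 2 ≤ a ^ 2 * V) (hf2 : l ^ 2 * ∑ i, f i ^ 2 ≤ b ^ 2 * V)
    (hg1 : ∑ i, g i ^ 2 ≤ a ^ 2 * W) (hg2 : l' ^ 2 * ∑ i, g i ^ 2 ≤ b ^ 2 * W)
    (hδ : (a * b) * |l - l'| / ((b + a * l) * (b + a * l')) ≤ δ) :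
    |∑ i, (l' - l) * (f i * g i)| ≤ 4 * (a * b) * δ * (√V * √W) := by
  have hf := sqrt_le_of_two_bounds ha hb hl hf1 hf2
  have hg := sqrt_le_of_two_bounds ha hb hl' hg1 hg2
  rw [← Finset.mul_sum, abs_mul, abs_sub_comm]
  have hcs : |∑ i, f i * g i| ≤ √(∑ i, f i ^ 2) * √(∑ i, g i ^ 2) := by
    refine abs_le_of_sq_le_sq ?_ (by positivity)
    rw [mul_pow, Real.sq_sqrt (Finset.sum_nonneg fun i _ => sq_nonneg (f i)),
      Real.sq_sqrt (Finset.sum_nonneg fun i _ => sq_nonneg (g i))]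
    exact Finset.sum_mul_sq_le_sq_mul_sq _ _ _
  have h1 : 0 < b + a * l := by positivity
  have h2 : 0 < b + a * l' := by positivity
  calc |l - l'| * |∑ i, f i * g i|
      ≤ |l - l'| * ((2 * (a * b) / (b + a * l) * √V) * (2 * (a * b) / (b + a * l') * √W)) := by
        refine mul_le_mul_of_nonneg_left (hcs.trans ?_) (abs_nonneg _)
        exact mul_le_mul hf hg (Real.sqrt_nonneg _) (by positivity)
    _ = 4 * (a * b) * ((a * b) * |l - l'| / ((b + a * l) * (b + a * l'))) * (√V * √W) := by
        field_simp
        ring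
    _ ≤ _ := by gcongr

/-- With `n ^ 2` points of `[0, ∞) ^ 2` one approximates all the `Σ⁻¹` up to `8 √(Λ ν) / n`, in the
operator norm between the spaces with norms weighted by `M⁻¹`. -/
theorem exists_net (hK : Estimable K) (hr : 0 < r) (hc : 0 < c) {k1 k2 : ℝ} (hk1 : 0 < k1)
    (h1 : ∀ e : Obs K, k1 ≤ K e.1.1 e.1.2) (h2 : ∀ e : Obs K, (K e.1.1 e.1.2 : ℝ) ≤ k2)
    {n : ℕ} (hn : 0 < n) :
    ∃ g : Fin n × Fin n → ℝ × ℝ, (∀ k, 0 ≤ (g k).1 ∧ 0 ≤ (g k).2) ∧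
      ∀ lA lB, 0 ≤ lA → 0 ≤ lB → ∃ k, ∀ v x : Obs K → ℝ,
        |v ⬝ᵥ ((sigmaMat K lA lB)⁻¹ *ᵥ x) - v ⬝ᵥ ((sigmaMat K (g k).1 (g k).2)⁻¹ *ᵥ x)| ≤
          8 * √(lambdaMax (lossQ K) * (k2 / k1)) / n * (√(weightedSq K v) * √(weightedSq K x)) := by
  obtain ⟨e0⟩ := nonempty_obs hK hr hc
  have hk2 : 0 < k2 := hk1.trans_le ((h1 e0).trans (h2 e0))
  have hΛ : 0 < lambdaMax (lossQ K) := zero_lt_one.trans_le (one_le_lambdaMax_lossQ hK hr hc)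
  set L := lambdaMax (lossQ K) with hL
  have hr' : (0 : ℝ) < r := Nat.cast_pos.2 hr
  have hc' : (0 : ℝ) < c := Nat.cast_pos.2 hc
  have hab : ∀ s : ℝ, 0 < s → √(s * k2) * √(L / (s * k1)) = √(L * (k2 / k1)) := fun s hs => by
    rw [← Real.sqrt_mul (by positivity)]
    congr 1
    field_simp
  have ha : ∀ s : ℝ, 0 < s → 0 < √(s * k2) := fun s hs => Real.sqrt_pos.2 (by positivity)
  have hb : ∀ s : ℝ, 0 < s → 0 < √(L / (s * k1)) := fun s hs => Real.sqrt_pos.2 (by positivity)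
  obtain ⟨gA, gA0, hgA⟩ := exists_grid (ha c hc') (hb c hc') hn
  obtain ⟨gB, gB0, hgB⟩ := exists_grid (ha r hr') (hb r hr') hn
  refine ⟨fun k => (gA k.1, gB k.2), fun k => ⟨gA0 _, gB0 _⟩, fun lA lB hA hB => ?_⟩
  obtain ⟨kA, hkA⟩ := hgA lA hA
  obtain ⟨kB, hkB⟩ := hgB lB hB
  refine ⟨(kA, kB), fun v x => ?_⟩
  have key := dotProduct_sigma_inv_sub (obsDesign K) (cell_inv_pos K) (elim_nonneg hA hB)
    (elim_nonneg (gA0 kA) (gB0 kB)) v x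
  change v ⬝ᵥ ((sigmaMat K lA lB)⁻¹ *ᵥ x) - v ⬝ᵥ ((sigmaMat K (gA kA) (gB kB))⁻¹ *ᵥ x) =
    ∑ q, _ * (((obsDesign K)ᵀ *ᵥ ((sigmaMat K lA lB)⁻¹ *ᵥ v)) q *
      ((obsDesign K)ᵀ *ᵥ ((sigmaMat K (gA kA) (gB kB))⁻¹ *ᵥ x)) q) at key
  rw [key, Fintype.sum_sum_type]
  simp only [Sum.elim_inl, Sum.elim_inr]
  have rowA : ∀ {lA lB : ℝ}, 0 ≤ lA → 0 ≤ lB → ∀ y : Obs K → ℝ,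
      lA ^ 2 * ∑ i, ((obsDesign K)ᵀ *ᵥ ((sigmaMat K lA lB)⁻¹ *ᵥ y)) (Sum.inl i) ^ 2 ≤
        √(L / (c * k1)) ^ 2 * weightedSq K y := fun {lA lB} hA hB y => by
    have h := sum_predicted_effects_sq_le hK hk1 h1 hΛ.le hA hB y
    have h0 : 0 ≤ (r : ℝ) * (lB ^ 2 *
      ∑ j, ((obsDesign K)ᵀ *ᵥ ((sigmaMat K lA lB)⁻¹ *ᵥ y)) (Sum.inr j) ^ 2) := by positivity
    rw [Real.sq_sqrt (by positivity)]
    have h3 : L / (c * k1) * weightedSq K y = (L / k1 * weightedSq K y) / c := by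
      field_simp
    rw [h3, le_div_iff₀ hc']
    linarith
  have colB : ∀ {lA lB : ℝ}, 0 ≤ lA → 0 ≤ lB → ∀ y : Obs K → ℝ,
      lB ^ 2 * ∑ j, ((obsDesign K)ᵀ *ᵥ ((sigmaMat K lA lB)⁻¹ *ᵥ y)) (Sum.inr j) ^ 2 ≤
        √(L / (r * k1)) ^ 2 * weightedSq K y := fun {lA lB} hA hB y => by
    have h := sum_predicted_effects_sq_le hK hk1 h1 hΛ.le hA hB y
    have h0 : 0 ≤ (c : ℝ) * (lA ^ 2 *
      ∑ i, ((obsDesign K)ᵀ *ᵥ ((sigmaMat K lA lB)⁻¹ *ᵥ y)) (Sum.inl i) ^ 2) := by positivity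
    rw [Real.sq_sqrt (by positivity)]
    have h3 : L / (r * k1) * weightedSq K y = (L / k1 * weightedSq K y) / r := by
      field_simp
    rw [h3, le_div_iff₀ hr']
    linarith
  have row1 : ∀ {lA lB : ℝ}, 0 ≤ lA → 0 ≤ lB → ∀ y : Obs K → ℝ,
      ∑ i, ((obsDesign K)ᵀ *ᵥ ((sigmaMat K lA lB)⁻¹ *ᵥ y)) (Sum.inl i) ^ 2 ≤
        √(c * k2) ^ 2 * weightedSq K y := fun hA hB y => by
    rw [Real.sq_sqrt (by positivity)]
    exact sum_row_sq_le h2 hA hB y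
  have col1 : ∀ {lA lB : ℝ}, 0 ≤ lA → 0 ≤ lB → ∀ y : Obs K → ℝ,
      ∑ j, ((obsDesign K)ᵀ *ᵥ ((sigmaMat K lA lB)⁻¹ *ᵥ y)) (Sum.inr j) ^ 2 ≤
        √(r * k2) ^ 2 * weightedSq K y := fun hA hB y => by
    rw [Real.sq_sqrt (by positivity)]
    exact sum_col_sq_le h2 hA hB y
  have bA := abs_sum_block_le (ha c hc') (hb c hc') hA (gA0 kA) (row1 hA hB v) (rowA hA hB v)
    (row1 (gA0 kA) (gB0 kB) x) (rowA (gA0 kA) (gB0 kB) x) hkA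
  have bB := abs_sum_block_le (ha r hr') (hb r hr') hB (gB0 kB) (col1 hA hB v) (colB hA hB v)
    (col1 (gA0 kA) (gB0 kB) x) (colB (gA0 kA) (gB0 kB) x) hkB
  rw [hab c hc'] at bA
  rw [hab r hr'] at bB
  refine (abs_add_le _ _).trans ((add_le_add bA bB).trans_eq ?_)
  ring

end Net

/-! ### Second moments of linear and quadratic forms in independent Gaussian variables -/

/-- The fourth moment of the standard normal law. Its value is irrelevant, only its finiteness
matters. -/
noncomputable def gaussianFourth : ℝ := ∫ x, x ^ 4 ∂gaussianReal 0 1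

theorem gaussianFourth_nonneg : 0 ≤ gaussianFourth :=
  integral_nonneg fun x => by positivity

theorem integrable_sub_pow_gaussianReal (a : ℝ) (v : ℝ≥0) (n : ℕ) :
    Integrable (fun x => (x - a) ^ n) (gaussianReal a v) := by
  have h : MemLp (fun x : ℝ => x - a) n (gaussianReal a v) :=
    (memLp_id_gaussianReal' n (ENNReal.natCast_ne_top n)).sub (memLp_const a)
  refine (integrable_norm_iff (by fun_prop)).1 ?_
  simpa only [norm_pow] using h.integrable_norm_pow'

theorem integral_sub_gaussianReal (a : ℝ) (v : ℝ≥0) : ∫ x, (x - a) ∂gaussianReal a v = 0 := by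
  have h := integral_sub ((memLp_id_gaussianReal' (μ := a) (v := v) 1 (by simp)).integrable le_rfl)
    (integrable_const a)
  simp only [id] at h
  rw [h, integral_id_gaussianReal]
  simp

theorem integral_sub_sq_gaussianReal (a : ℝ) (v : ℝ≥0) :
    ∫ x, (x - a) ^ 2 ∂gaussianReal a v = v := by
  have h := variance_fun_id_gaussianReal (μ := a) (v := v)
  rwa [variance_eq_integral (by fun_prop), integral_id_gaussianReal] at h

theorem integral_sub_pow_four_gaussianReal (a : ℝ) (v : ℝ≥0) :
    ∫ x, (x - a) ^ 4 ∂gaussianReal a v = gaussianFourth * (v : ℝ) ^ 2 := by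
  have h : gaussianReal a v = (gaussianReal 0 1).map (fun x => √v * x + a) := by
    have h1 := gaussianReal_map_const_mul (μ := 0) (v := 1) (√v)
    have h2 := gaussianReal_map_add_const (μ := 0) (v := v) a
    have h3 : NNReal.mk (√v ^ 2) (sq_nonneg _) * 1 = v := by
      ext
      simp
    rw [h3, mul_zero] at h1
    rw [zero_add, ← h1, Measure.map_map (by fun_prop) (by fun_prop)] at h2
    exact h2.symm
  rw [h, integral_map (by fun_prop) (by fun_prop)]
  have h4 : √(v : ℝ) ^ 4 = (v : ℝ) ^ 2 := by
    rw [show (4 : ℕ) = 2 * 2 from rfl, pow_mul, Real.sq_sqrt (NNReal.coe_nonneg v)]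
  simp only [add_sub_cancel_right, mul_pow, h4]
  rw [integral_const_mul, gaussianFourth, mul_comm]

section Moments

variable {ι : Type*}

/-- The product `z e * z f` minus its mean. -/
noncomputable def centeredPair [DecidableEq ι] (η : ι → ℝ) (v : ι → ℝ≥0) (e f : ι)
    (x : ι → ℝ) : ℝ :=
  (x e - η e) * (x f - η f) - if e = f then (v e : ℝ) else 0

theorem centeredPair_mul [DecidableEq ι] (η : ι → ℝ) (v : ι → ℝ≥0) (e f g h : ι) (x : ι → ℝ) :
    centeredPair η v e f x * centeredPair η v g h x =
      (x e - η e) * (x f - η f) * (x g - η g) * (x h - η h) -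
        (if e = f then (v e : ℝ) else 0) * ((x g - η g) * (x h - η h)) -
        (if g = h then (v g : ℝ) else 0) * ((x e - η e) * (x f - η f)) +
        (if e = f then (v e : ℝ) else 0) * (if g = h then (v g : ℝ) else 0) := by
  unfold centeredPair
  ring

variable [Fintype ι]

/-- Independent Gaussian variables with means `η i` and variances `v i`. -/
noncomputable def gaussianPi (η : ι → ℝ) (v : ι → ℝ≥0) : Measure (ι → ℝ) :=
  Measure.pi fun i => gaussianReal (η i) (v i)

instance (η : ι → ℝ) (v : ι → ℝ≥0) : IsProbabilityMeasure (gaussianPi η v) := by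
  unfold gaussianPi
  infer_instance

theorem integrable_monomial (η : ι → ℝ) (v : ι → ℝ≥0) (n : ι → ℕ) :
    Integrable (fun x => ∏ i, (x i - η i) ^ n i) (gaussianPi η v) :=
  Integrable.fintype_prod (f := fun i t => (t - η i) ^ n i)
    fun i => integrable_sub_pow_gaussianReal (η i) (v i) (n i)

theorem integral_monomial (η : ι → ℝ) (v : ι → ℝ≥0) (n : ι → ℕ) :
    ∫ x, ∏ i, (x i - η i) ^ n i ∂gaussianPi η v =
      ∏ i, ∫ t, (t - η i) ^ n i ∂gaussianReal (η i) (v i) :=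
  integral_fintype_prod_eq_prod (fun i t => (t - η i) ^ n i)

theorem integral_monomial_eq_zero (η : ι → ℝ) (v : ι → ℝ≥0) {n : ι → ℕ} {i : ι} (hi : n i = 1) :
    ∫ x, ∏ i, (x i - η i) ^ n i ∂gaussianPi η v = 0 := by
  rw [integral_monomial]
  refine Finset.prod_eq_zero (Finset.mem_univ i) ?_
  simp [hi, integral_sub_gaussianReal]

theorem integral_monomial_single (η : ι → ℝ) (v : ι → ℝ≥0) {n : ι → ℕ} (e : ι)
    (hn : ∀ i, i ≠ e → n i = 0) :
    ∫ x, ∏ i, (x i - η i) ^ n i ∂gaussianPi η v =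
      ∫ t, (t - η e) ^ n e ∂gaussianReal (η e) (v e) := by
  rw [integral_monomial]
  refine Finset.prod_eq_single e (fun i _ hi => ?_) (fun h => absurd (Finset.mem_univ _) h)
  simp [hn i hi]

theorem integral_monomial_pair (η : ι → ℝ) (v : ι → ℝ≥0) {n : ι → ℕ} {e f : ι} (hef : e ≠ f)
    (he : n e = 2) (hf : n f = 2) (hn : ∀ i, i ≠ e → i ≠ f → n i = 0) :
    ∫ x, ∏ i, (x i - η i) ^ n i ∂gaussianPi η v = v e * v f := by
  rw [integral_monomial, Finset.prod_eq_mul e f hef (fun i _ hi => by simp [hn i hi.1 hi.2])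
    (fun h => absurd (Finset.mem_univ _) h) (fun h => absurd (Finset.mem_univ _) h), he, hf,
    integral_sub_sq_gaussianReal, integral_sub_sq_gaussianReal]

variable [DecidableEq ι]

/-- The exponents of the monomial `z e * z f * z g * z h`. -/
def fourExponents (e f g h i : ι) : ℕ :=
  (if i = e then 1 else 0) + (if i = f then 1 else 0) + (if i = g then 1 else 0) +
    (if i = h then 1 else 0)

theorem prod_fourExponents (z : ι → ℝ) (e f g h : ι) :
    ∏ i, z i ^ fourExponents e f g h i = z e * z f * z g * z h := by
  have h1 : ∀ e, ∏ i, z i ^ (if i = e then 1 else 0) = z e := fun e => by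
    simp [pow_ite]
  simp only [fourExponents, pow_add, Finset.prod_mul_distrib, h1]

theorem integrable_four (η : ι → ℝ) (v : ι → ℝ≥0) (e f g h : ι) :
    Integrable (fun x => (x e - η e) * (x f - η f) * (x g - η g) * (x h - η h))
      (gaussianPi η v) := by
  have := integrable_monomial η v (fourExponents e f g h)
  simpa only [prod_fourExponents (fun i => _ - η i)] using this

/-- Wick's formula for the fourth mixed moments. The value `3` of `gaussianFourth`, which removes
the last term, is not used. -/
theorem integral_four (η : ι → ℝ) (v : ι → ℝ≥0) (e f g h : ι) :
    ∫ x, (x e - η e) * (x f - η f) * (x g - η g) * (x h - η h) ∂gaussianPi η v =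
      (if e = f then (v e : ℝ) else 0) * (if g = h then (v g : ℝ) else 0) +
      (if e = g then (v e : ℝ) else 0) * (if f = h then (v f : ℝ) else 0) +
      (if e = h then (v e : ℝ) else 0) * (if f = g then (v f : ℝ) else 0) +
      (gaussianFourth - 3) * (if e = f ∧ e = g ∧ e = h then (v e : ℝ) ^ 2 else 0) := by
  have h0 : ∀ x : ι → ℝ, (x e - η e) * (x f - η f) * (x g - η g) * (x h - η h) =
      ∏ i, (x i - η i) ^ fourExponents e f g h i := fun x =>
    (prod_fourExponents (fun i => x i - η i) e f g h).symm
  simp only [h0]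
  clear h0
  by_cases hef : e = f
  · subst hef
    by_cases hgh : g = h
    · subst hgh
      by_cases heg : e = g
      · subst heg
        rw [integral_monomial_single η v e fun i hi => by simp [fourExponents, hi]]
        simp only [fourExponents, if_true, and_self]
        rw [integral_sub_pow_four_gaussianReal]
        ring
      · rw [integral_monomial_pair η v heg (by simp [fourExponents, heg])
          (by simp [fourExponents, Ne.symm heg])
          fun i h1 h2 => by simp [fourExponents, h1, h2]]
        simp [heg]
    · by_cases heg : e = g
      · subst heg
        rw [integral_monomial_eq_zero η v (i := h) (by simp [fourExponents, Ne.symm hgh])]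
        simp [hgh]
      · rw [integral_monomial_eq_zero η v (i := g) (by simp [fourExponents, Ne.symm heg, hgh])]
        simp [hgh, heg]
  · by_cases heg : e = g
    · subst heg
      by_cases hfh : f = h
      · subst hfh
        rw [integral_monomial_pair η v hef (by simp [fourExponents, hef])
          (by simp [fourExponents, Ne.symm hef])
          fun i h1 h2 => by simp [fourExponents, h1, h2]]
        simp [hef]
      · rw [integral_monomial_eq_zero η v (i := f) (by simp [fourExponents, Ne.symm hef, hfh])]
        simp [hef, hfh, Ne.symm hef]
    · by_cases heh : e = h
      · subst heh
        by_cases hfg : f = g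
        · subst hfg
          rw [integral_monomial_pair η v hef (by simp [fourExponents, hef])
            (by simp [fourExponents, Ne.symm hef])
            fun i h1 h2 => by simp [fourExponents, h1, h2]]
          simp [hef]
        · rw [integral_monomial_eq_zero η v (i := f)
            (by simp [fourExponents, Ne.symm hef, hfg])]
          simp [hef, hfg, heg]
      · rw [integral_monomial_eq_zero η v (i := e) (by simp [fourExponents, hef, heg, heh])]
        simp [hef, heg, heh]

theorem prod_twoExponents (z : ι → ℝ) (e f : ι) :
    ∏ i, z i ^ ((if i = e then 1 else 0) + (if i = f then 1 else 0)) = z e * z f := by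
  have h1 : ∀ e, ∏ i, z i ^ (if i = e then 1 else 0) = z e := fun e => by
    simp [pow_ite]
  simp only [pow_add, Finset.prod_mul_distrib, h1]

theorem integrable_two (η : ι → ℝ) (v : ι → ℝ≥0) (e f : ι) :
    Integrable (fun x => (x e - η e) * (x f - η f)) (gaussianPi η v) := by
  have := integrable_monomial η v fun i => (if i = e then 1 else 0) + (if i = f then 1 else 0)
  simpa only [prod_twoExponents (fun i => _ - η i)] using this

theorem integral_two (η : ι → ℝ) (v : ι → ℝ≥0) (e f : ι) :
    ∫ x, (x e - η e) * (x f - η f) ∂gaussianPi η v = if e = f then (v e : ℝ) else 0 := by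
  have h0 : ∀ x : ι → ℝ, (x e - η e) * (x f - η f) =
      ∏ i, (x i - η i) ^ ((if i = e then 1 else 0) + (if i = f then 1 else 0)) := fun x =>
    (prod_twoExponents (fun i => x i - η i) e f).symm
  simp only [h0]
  by_cases hef : e = f
  · subst hef
    rw [integral_monomial_single η v e fun i hi => by simp [hi]]
    simp [integral_sub_sq_gaussianReal]
  · rw [integral_monomial_eq_zero η v (i := e) (by simp [hef])]
    simp [hef]

theorem integrable_linear_sq (η : ι → ℝ) (v : ι → ℝ≥0) (a : ι → ℝ) :
    Integrable (fun x => (∑ e, a e * (x e - η e)) ^ 2) (gaussianPi η v) := by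
  have h0 : ∀ x : ι → ℝ, (∑ e, a e * (x e - η e)) ^ 2 =
      ∑ e, ∑ f, a e * a f * ((x e - η e) * (x f - η f)) := fun x => by
    rw [sq, Finset.sum_mul_sum]
    exact Finset.sum_congr rfl fun e _ => Finset.sum_congr rfl fun f _ => by ring
  simp only [h0]
  exact integrable_finsetSum _ fun e _ => integrable_finsetSum _ fun f _ =>
    (integrable_two η v e f).const_mul _

theorem integral_linear_sq (η : ι → ℝ) (v : ι → ℝ≥0) (a : ι → ℝ) :
    ∫ x, (∑ e, a e * (x e - η e)) ^ 2 ∂gaussianPi η v = ∑ e, a e ^ 2 * v e := by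
  have h0 : ∀ x : ι → ℝ, (∑ e, a e * (x e - η e)) ^ 2 =
      ∑ e, ∑ f, a e * a f * ((x e - η e) * (x f - η f)) := fun x => by
    rw [sq, Finset.sum_mul_sum]
    exact Finset.sum_congr rfl fun e _ => Finset.sum_congr rfl fun f _ => by ring
  simp only [h0]
  rw [integral_finsetSum _ fun e _ => integrable_finsetSum _ fun f _ =>
    (integrable_two η v e f).const_mul _]
  refine Finset.sum_congr rfl fun e _ => ?_
  rw [integral_finsetSum _ fun f _ => (integrable_two η v e f).const_mul _]
  simp only [integral_const_mul, integral_two]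
  simp [sq]

theorem integrable_centeredPair_mul (η : ι → ℝ) (v : ι → ℝ≥0) (e f g h : ι) :
    Integrable (fun x => centeredPair η v e f x * centeredPair η v g h x) (gaussianPi η v) := by
  simp only [centeredPair_mul]
  exact (((integrable_four η v e f g h).sub ((integrable_two η v g h).const_mul _)).sub
    ((integrable_two η v e f).const_mul _)).add (integrable_const _)

theorem integral_centeredPair_mul (η : ι → ℝ) (v : ι → ℝ≥0) (e f g h : ι) :
    ∫ x, centeredPair η v e f x * centeredPair η v g h x ∂gaussianPi η v =
      (if e = g then (v e : ℝ) else 0) * (if f = h then (v f : ℝ) else 0) +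
      (if e = h then (v e : ℝ) else 0) * (if f = g then (v f : ℝ) else 0) +
      (gaussianFourth - 3) * (if e = f ∧ e = g ∧ e = h then (v e : ℝ) ^ 2 else 0) := by
  have i1 := integrable_four η v e f g h
  have i2 := (integrable_two η v g h).const_mul (if e = f then (v e : ℝ) else 0)
  have i3 := (integrable_two η v e f).const_mul (if g = h then (v g : ℝ) else 0)
  have i4 : Integrable (fun x => (x e - η e) * (x f - η f) * (x g - η g) * (x h - η h) -
      (if e = f then (v e : ℝ) else 0) * ((x g - η g) * (x h - η h))) (gaussianPi η v) := i1.sub i2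
  have i5 : Integrable (fun x => (x e - η e) * (x f - η f) * (x g - η g) * (x h - η h) -
      (if e = f then (v e : ℝ) else 0) * ((x g - η g) * (x h - η h)) -
      (if g = h then (v g : ℝ) else 0) * ((x e - η e) * (x f - η f))) (gaussianPi η v) :=
    i4.sub i3
  simp only [centeredPair_mul]
  rw [integral_add i5 (integrable_const _), integral_sub i4 i3,
    integral_sub i1 i2, integral_const_mul, integral_const_mul, integral_four, integral_two,
    integral_two, integral_const]
  simp only [probReal_univ, smul_eq_mul, one_mul]
  ring

theorem sum_centeredPair (η : ι → ℝ) (v : ι → ℝ≥0) (A : ι → ι → ℝ) (x : ι → ℝ) :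
    ∑ e, ∑ f, A e f * ((x e - η e) * (x f - η f)) - ∑ e, A e e * v e =
      ∑ e, ∑ f, A e f * centeredPair η v e f x := by
  simp only [centeredPair, mul_sub, Finset.sum_sub_distrib, mul_ite, mul_zero,
    Finset.sum_ite_eq, Finset.mem_univ, if_true]

theorem sum_centeredPair_sq (η : ι → ℝ) (v : ι → ℝ≥0) (A : ι → ι → ℝ) (x : ι → ℝ) :
    (∑ e, ∑ f, A e f * ((x e - η e) * (x f - η f)) - ∑ e, A e e * v e) ^ 2 =
      ∑ e, ∑ f, ∑ g, ∑ h, A e f * A g h *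
        (centeredPair η v e f x * centeredPair η v g h x) := by
  rw [sum_centeredPair, sq, Finset.sum_mul]
  refine Finset.sum_congr rfl fun e _ => ?_
  rw [Finset.sum_mul]
  refine Finset.sum_congr rfl fun f _ => ?_
  rw [Finset.mul_sum]
  refine Finset.sum_congr rfl fun g _ => ?_
  rw [Finset.mul_sum]
  exact Finset.sum_congr rfl fun h _ => by ring

theorem integrable_quadratic_sq (η : ι → ℝ) (v : ι → ℝ≥0) (A : ι → ι → ℝ) :
    Integrable (fun x => (∑ e, ∑ f, A e f * ((x e - η e) * (x f - η f)) - ∑ e, A e e * v e) ^ 2)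
      (gaussianPi η v) := by
  simp only [sum_centeredPair_sq]
  exact integrable_finsetSum _ fun e _ => integrable_finsetSum _ fun f _ =>
    integrable_finsetSum _ fun g _ => integrable_finsetSum _ fun h _ =>
      (integrable_centeredPair_mul η v e f g h).const_mul _

theorem integral_quadratic_sq_le (η : ι → ℝ) (v : ι → ℝ≥0) (A : ι → ι → ℝ) :
    ∫ x, (∑ e, ∑ f, A e f * ((x e - η e) * (x f - η f)) - ∑ e, A e e * v e) ^ 2
        ∂gaussianPi η v ≤
      (2 + gaussianFourth) * ∑ e, ∑ f, A e f ^ 2 * (v e * v f) := by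
  have h4 : ∀ e f g h, Integrable (fun x => A e f * A g h *
      (centeredPair η v e f x * centeredPair η v g h x)) (gaussianPi η v) := fun e f g h =>
    (integrable_centeredPair_mul η v e f g h).const_mul _
  have hint : ∫ x, (∑ e, ∑ f, A e f * ((x e - η e) * (x f - η f)) - ∑ e, A e e * v e) ^ 2
        ∂gaussianPi η v = ∑ e, ∑ f, (A e f * A e f * (v e * v f) + A e f * A f e * (v e * v f) +
          if e = f then (gaussianFourth - 3) * (A e f * A e f * (v e) ^ 2) else 0) := by
    simp only [sum_centeredPair_sq]
    rw [integral_finsetSum _ fun e _ => integrable_finsetSum _ fun f _ =>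
      integrable_finsetSum _ fun g _ => integrable_finsetSum _ fun h _ => h4 e f g h]
    refine Finset.sum_congr rfl fun e _ => ?_
    rw [integral_finsetSum _ fun f _ =>
      integrable_finsetSum _ fun g _ => integrable_finsetSum _ fun h _ => h4 e f g h]
    refine Finset.sum_congr rfl fun f _ => ?_
    rw [integral_finsetSum _ fun g _ => integrable_finsetSum _ fun h _ => h4 e f g h]
    have h1 : ∀ g, ∫ x, ∑ h, A e f * A g h *
        (centeredPair η v e f x * centeredPair η v g h x) ∂gaussianPi η v =
        ∑ h, A e f * A g h * ((if e = g then (v e : ℝ) else 0) * (if f = h then (v f : ℝ) else 0) +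
        (if e = h then (v e : ℝ) else 0) * (if f = g then (v f : ℝ) else 0) +
        (gaussianFourth - 3) * (if e = f ∧ e = g ∧ e = h then (v e : ℝ) ^ 2 else 0)) := fun g => by
      rw [integral_finsetSum _ fun h _ => h4 e f g h]
      simp only [integral_const_mul, integral_centeredPair_mul]
    simp only [h1, mul_add, Finset.sum_add_distrib]
    congr 1
    · congr 1
      · simp
      · simp
    · by_cases hef : e = f
      · subst hef
        simp [ite_and]
        ring
      · simp [hef]
  rw [hint]
  have hb : ∑ e, ∑ f, A f e ^ 2 * ((v e : ℝ) * v f) = ∑ e, ∑ f, A e f ^ 2 * ((v e : ℝ) * v f) := by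
    rw [Finset.sum_comm]
    exact Finset.sum_congr rfl fun e _ => Finset.sum_congr rfl fun f _ => by ring
  calc _ ≤ ∑ e, ∑ f, ((3 / 2 + gaussianFourth) * (A e f ^ 2 * ((v e : ℝ) * v f)) +
        1 / 2 * (A f e ^ 2 * ((v e : ℝ) * v f))) := by
        refine Finset.sum_le_sum fun e _ => Finset.sum_le_sum fun f _ => ?_
        have hv : 0 ≤ (v e : ℝ) * v f := by positivity
        have h1 := mul_nonneg hv (sq_nonneg (A e f - A f e))
        have h2 : (if e = f then (gaussianFourth - 3) * (A e f * A e f * (v e : ℝ) ^ 2) else 0) ≤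
            gaussianFourth * (A e f ^ 2 * ((v e : ℝ) * v f)) := by
          split_ifs with h
          · subst h
            have : 0 ≤ A e e ^ 2 * ((v e : ℝ) * v e) := by positivity
            nlinarith
          · exact mul_nonneg gaussianFourth_nonneg (by positivity)
        nlinarith
    _ = _ := by
        simp only [Finset.sum_add_distrib, ← Finset.mul_sum]
        rw [hb]
        ring

end Moments

/-! ### Empirical quantiles are bounded by the empirical second moment -/

theorem sq_mul_card_le_sum_sq {ι : Type*} [Fintype ι] (y : ι → ℝ) (s : Finset ι) {x a : ℝ}
    (ha : a ≤ s.card) (hs : ∀ i ∈ s, x ^ 2 ≤ y i ^ 2) : x ^ 2 * a ≤ ∑ i, y i ^ 2 :=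
  calc x ^ 2 * a ≤ x ^ 2 * s.card := mul_le_mul_of_nonneg_left ha (sq_nonneg x)
    _ = ∑ i ∈ s, x ^ 2 := by rw [Finset.sum_const, nsmul_eq_mul, mul_comm]
    _ ≤ ∑ i ∈ s, y i ^ 2 := Finset.sum_le_sum hs
    _ ≤ ∑ i, y i ^ 2 := Finset.sum_le_univ_sum_of_nonneg fun i => sq_nonneg (y i)

/-- At least a fraction `τ / 2` of the observations is as far from `0` as any point between the
`τ / 2` and the `1 - τ / 2` quantile. -/
theorem sq_mul_card_le_of_mem_quantile {ι : Type*} [Fintype ι] (y : ι → ℝ) {τ : ℝ}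
    (hτ : τ ∈ Set.Ioc (0 : ℝ) 1) {m : ℝ}
    (hm : m ∈ Set.Icc (quantile y (τ / 2)) (quantile y (1 - τ / 2))) :
    m ^ 2 * (τ / 2 * Fintype.card ι) ≤ ∑ i, y i ^ 2 := by
  classical
  obtain ⟨hτ0, hτ1⟩ := hτ
  rcases isEmpty_or_nonempty ι with hE | hE
  · simp
  have hn : (0 : ℝ) < Fintype.card ι := Nat.cast_pos.2 Fintype.card_pos
  have hcard : ∀ x, (({i | y i ≤ x} : Set ι).ncard : ℝ) =
      ((Finset.univ.filter fun i => y i ≤ x).card : ℝ) := fun x => by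
    rw [Set.ncard_eq_toFinset_card']
    simp
  have hcont : ∀ s : Set ℝ, Tendsto (fun x : ℝ => x ^ 2 * (τ / 2 * Fintype.card ι)) (𝓝[s] m)
      (𝓝 (m ^ 2 * (τ / 2 * Fintype.card ι))) := fun s =>
    (Continuous.tendsto (by fun_prop) m).mono_left nhdsWithin_le_nhds
  rcases lt_trichotomy m 0 with h0 | h0 | h0
  · refine le_of_tendsto (hcont (Set.Ioi m)) ?_
    filter_upwards [Ioo_mem_nhdsGT h0] with x hx
    have hlt : quantile y (τ / 2) < x := hm.1.trans_lt hx.1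
    obtain ⟨b, hb⟩ := (Set.finite_range y).bddAbove
    have hne : {x : ℝ | τ / 2 * (Fintype.card ι : ℝ) ≤
        (({i | y i ≤ x} : Set ι).ncard : ℝ)}.Nonempty := by
      refine ⟨b, ?_⟩
      have : ({i | y i ≤ b} : Set ι) = Set.univ := by
        ext i
        simpa using hb ⟨i, rfl⟩
      rw [Set.mem_ofPred_eq, this, Set.ncard_univ, Nat.card_eq_fintype_card]
      nlinarith
    obtain ⟨s, hs, hsx⟩ := exists_lt_of_csInf_lt hne hlt
    rw [Set.mem_ofPred_eq, hcard] at hs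
    refine sq_mul_card_le_sum_sq y _ hs fun i hi => ?_
    have := (Finset.mem_filter.1 hi).2
    nlinarith [hx.2]
  · rw [h0]
    simpa using Finset.sum_nonneg fun i (_ : i ∈ Finset.univ) => sq_nonneg (y i)
  · refine le_of_tendsto (hcont (Set.Iio m)) ?_
    filter_upwards [Ioo_mem_nhdsLT h0] with x hx
    have hlt : x < quantile y (1 - τ / 2) := hx.2.trans_le hm.2
    have hbdd : BddBelow {x : ℝ | (1 - τ / 2) * (Fintype.card ι : ℝ) ≤
        (({i | y i ≤ x} : Set ι).ncard : ℝ)} := by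
      obtain ⟨b, hb⟩ := (Set.finite_range y).bddBelow
      refine ⟨b, fun x hx => ?_⟩
      by_contra! hlt
      have : ({i | y i ≤ x} : Set ι) = ∅ := by
        ext i
        simpa using hlt.trans_le (hb ⟨i, rfl⟩)
      rw [Set.mem_ofPred_eq, this, Set.ncard_empty, Nat.cast_zero] at hx
      nlinarith
    have hs := notMem_of_lt_csInf hlt hbdd
    rw [Set.mem_ofPred_eq, hcard, not_le] at hs
    have hsum : ((Finset.univ.filter fun i => y i ≤ x).card : ℝ) +
        ((Finset.univ.filter fun i => ¬ y i ≤ x).card : ℝ) = Fintype.card ι := by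
      rw [← Nat.cast_add, Finset.card_filter_add_card_filter_not, Finset.card_univ]
    refine sq_mul_card_le_sum_sq y (Finset.univ.filter fun i => ¬ y i ≤ x) (by linarith)
      fun i hi => ?_
    have := (Finset.mem_filter.1 hi).2
    nlinarith [hx.1]

/-! ### The loss and its unbiased estimate -/

section Fluctuation

variable {r c : ℕ} {K : Fin r → Fin c → ℕ}

/-- The bilinear form `uᵀ Q M S z`. -/
noncomputable def crossTerm (K : Fin r → Fin c → ℕ) (S : Matrix (Obs K) (Obs K) ℝ)
    (u z : Obs K → ℝ) : ℝ :=
  u ⬝ᵥ (lossQ K *ᵥ (covM K *ᵥ (S *ᵥ z)))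

theorem crossTerm_add (S : Matrix (Obs K) (Obs K) ℝ) (u z z' : Obs K → ℝ) :
    crossTerm K S u (z + z') = crossTerm K S u z + crossTerm K S u z' := by
  simp only [crossTerm, mulVec_add, dotProduct_add]

theorem crossTerm_smul (S : Matrix (Obs K) (Obs K) ℝ) (u z : Obs K → ℝ) (a : ℝ) :
    crossTerm K S u (a • z) = a * crossTerm K S u z := by
  simp only [crossTerm, mulVec_smul, dotProduct_smul, smul_eq_mul]

theorem continuous_crossTerm (u z : Obs K → ℝ) : Continuous fun S => crossTerm K S u z :=
  Continuous.dotProduct continuous_const (Continuous.matrix_mulVec continuous_const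
    (Continuous.matrix_mulVec continuous_const
      (Continuous.matrix_mulVec continuous_id continuous_const)))

theorem continuous_trace_mul : Continuous fun S : Matrix (Obs K) (Obs K) ℝ =>
    (S * covM K * lossQ K * covM K).trace :=
  (((continuous_id.matrix_mul continuous_const).matrix_mul continuous_const).matrix_mul
    continuous_const).matrix_trace

theorem transpose_covM (K : Fin r → Fin c → ℕ) : (covM K)ᵀ = covM K :=
  diagonal_transpose _

theorem crossTerm_eq (S : Matrix (Obs K) (Obs K) ℝ) (u z : Obs K → ℝ) :
    crossTerm K S u z = (covM K *ᵥ (lossQ K *ᵥ u)) ⬝ᵥ (S *ᵥ z) := by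
  rw [crossTerm, dotProduct_mulVec, dotProduct_mulVec, ← mulVec_transpose, ← mulVec_transpose,
    transpose_lossQ, transpose_covM]

theorem trace_eq_sum_crossTerm (S : Matrix (Obs K) (Obs K) ℝ) :
    (S * covM K * lossQ K * covM K).trace =
      ∑ e, crossTerm K S (Pi.single e 1) (covM K *ᵥ Pi.single e 1) := by
  have h : (S * covM K * lossQ K * covM K).trace = (lossQ K * covM K * S * covM K).trace := by
    rw [Matrix.mul_assoc, trace_mul_comm]
    simp only [Matrix.mul_assoc]
  rw [h, trace]
  refine Finset.sum_congr rfl fun e _ => ?_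
  simp only [crossTerm, mulVec_mulVec, Matrix.mul_assoc]
  simp

/-- The only part of the difference between `ure` and the actual loss that depends on the
hyper-parameters, up to a factor `2`. -/
noncomputable def fluctuation (K : Fin r → Fin c → ℕ) (σ : ℝ) (η y : Obs K → ℝ) (h : Hyper) : ℝ :=
  ((r : ℝ) * (c : ℝ))⁻¹ * (crossTerm K (sigmaInv K h.2) (y - η) (y - fun _ => h.1)
    - σ ^ 2 * (sigmaInv K h.2 * covM K * lossQ K * covM K).trace)

/-- A property of `Σ⁻¹` that is closed holds for all variance components in `[0, ∞]` as soon as it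
holds for the finite ones. -/
theorem sigmaInv_induction (K : Fin r → Fin c → ℕ) {s : Set (Matrix (Obs K) (Obs K) ℝ)}
    (hs : IsClosed s) (h : ∀ lA lB : ℝ, 0 ≤ lA → 0 ≤ lB → (sigmaMat K lA lB)⁻¹ ∈ s)
    (l : ℝ≥0∞ × ℝ≥0∞) : sigmaInv K l ∈ s := by
  have hcl : IsClosed (sigmaInv K ⁻¹' s) := hs.preimage (continuous_sigmaInv K)
  have hsub : {l : ℝ≥0∞ × ℝ≥0∞ | l.1 ≠ ⊤ ∧ l.2 ≠ ⊤} ⊆ sigmaInv K ⁻¹' s := fun l hl => by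
    rw [Set.mem_preimage, sigmaInv_of_ne_top K hl.1 hl.2]
    exact h _ _ ENNReal.toReal_nonneg ENNReal.toReal_nonneg
  exact hcl.closure_subset_iff.2 hsub (dense_finite l)

theorem transpose_sigmaInv (K : Fin r → Fin c → ℕ) (l : ℝ≥0∞ × ℝ≥0∞) :
    (sigmaInv K l)ᵀ = sigmaInv K l := by
  have hs : IsClosed {S : Matrix (Obs K) (Obs K) ℝ | Sᵀ = S} :=
    isClosed_eq (by fun_prop) continuous_id
  exact sigmaInv_induction K hs (fun lA lB hA hB =>
    transpose_sigma_inv (obsDesign K) (cell_inv_pos K) (elim_nonneg hA hB)) l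

theorem extrapolate_cellMean (hK : Estimable K) (μ : ℝ) (α : Fin r → ℝ) (β : Fin c → ℝ) :
    extrapolate K *ᵥ (fun e : Obs K => cellMean μ α β e.1) = cellMean μ α β := by
  have h1 : cellMean μ α β = fullDesign r c *ᵥ Sum.elim (fun i => μ + α i) β := by
    ext p
    simp [cellMean, fullDesign, mulVec, dotProduct]
  have h2 : (fun e : Obs K => cellMean μ α β e.1) =
      obsDesign K *ᵥ Sum.elim (fun i => μ + α i) β := by
    ext e
    rw [h1]
    rfl
  rw [h2, mulVec_mulVec, extrapolate_mul_obsDesign hK, h1]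

theorem loss_sub_ure (hK : Estimable K) (σ μ : ℝ) (α : Fin r → ℝ) (β : Fin c → ℝ)
    (y : Obs K → ℝ) (h : Hyper) :
    loss (cellMean μ α β) (cellEstimator K h y) - ure K σ y h =
      ((r : ℝ) * (c : ℝ))⁻¹ *
        ((y - fun e => cellMean μ α β e.1) ⬝ᵥ (lossQ K *ᵥ (y - fun e => cellMean μ α β e.1))
          - σ ^ 2 * (lossQ K * covM K).trace)
      - 2 * fluctuation K σ (fun e => cellMean μ α β e.1) y h := by
  set η : Obs K → ℝ := fun e => cellMean μ α β e.1 with hη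
  set z : Obs K → ℝ := y - fun _ => h.1 with hz
  set t := covM K *ᵥ (sigmaInv K h.2 *ᵥ z) with ht
  have h1 : cellEstimator K h y - cellMean μ α β = extrapolate K *ᵥ ((y - η) - t) := by
    rw [← extrapolate_cellMean hK μ α β, cellEstimator, ← mulVec_sub, shrink, ← mulVec_mulVec]
    congr 1
    simp only [← hη, ← hz, ← ht]
    abel
  have h2 : ∑ p, (cellEstimator K h y p - cellMean μ α β p) ^ 2 =
      ((y - η) - t) ⬝ᵥ (lossQ K *ᵥ ((y - η) - t)) := by
    rw [dotProduct_lossQ_mulVec, ← h1]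
    simp [dotProduct, sq]
  have h3 : t ⬝ᵥ (lossQ K *ᵥ (y - η)) = (y - η) ⬝ᵥ (lossQ K *ᵥ t) := by
    rw [dotProduct_lossQ_mulVec, dotProduct_lossQ_mulVec, dotProduct_comm]
  have h4 : z ⬝ᵥ ((sigmaInv K h.2 * covM K * lossQ K * covM K * sigmaInv K h.2) *ᵥ z) =
      t ⬝ᵥ (lossQ K *ᵥ t) := by
    have : t = (covM K * sigmaInv K h.2) *ᵥ z := by rw [ht, mulVec_mulVec]
    have e : ∀ w, t ⬝ᵥ w = z ⬝ᵥ ((covM K * sigmaInv K h.2)ᵀ *ᵥ w) := fun w => by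
      rw [this, dotProduct_mulVec, vecMul_transpose]
    rw [e, transpose_mul, transpose_sigmaInv, transpose_covM, ht]
    simp only [mulVec_mulVec, Matrix.mul_assoc]
  rw [loss, h2, ure, ← hz, h4, fluctuation, ← hz, crossTerm, ← ht]
  simp only [mulVec_sub, dotProduct_sub, sub_dotProduct] at h3 ⊢
  linear_combination (-((r : ℝ) * (c : ℝ))⁻¹) * h3

/-! ### Deterministic bounds on the bilinear forms -/

theorem weightedSq_le {k2 : ℝ} (h2 : ∀ e : Obs K, (K e.1.1 e.1.2 : ℝ) ≤ k2) (x : Obs K → ℝ) :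
    weightedSq K x ≤ k2 * ∑ e, x e ^ 2 := by
  rw [weightedSq, Finset.mul_sum]
  exact Finset.sum_le_sum fun e _ => mul_le_mul_of_nonneg_right (h2 e) (sq_nonneg _)

theorem weightedSq_covM_mulVec_le {k1 : ℝ} (hk1 : 0 < k1) (h1 : ∀ e : Obs K, k1 ≤ K e.1.1 e.1.2)
    (x : Obs K → ℝ) : weightedSq K (covM K *ᵥ x) ≤ k1⁻¹ * ∑ e, x e ^ 2 := by
  rw [weightedSq, Finset.mul_sum]
  refine Finset.sum_le_sum fun e _ => ?_
  rw [covM, mulVec_diagonal, mul_pow, ← mul_assoc]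
  refine mul_le_mul_of_nonneg_right ?_ (sq_nonneg _)
  have h0 : (0 : ℝ) < K e.1.1 e.1.2 := hk1.trans_le (h1 e)
  calc (K e.1.1 e.1.2 : ℝ) * ((K e.1.1 e.1.2 : ℝ)⁻¹) ^ 2 = (K e.1.1 e.1.2 : ℝ)⁻¹ := by
        field_simp
    _ ≤ k1⁻¹ := inv_anti₀ hk1 (h1 e)

theorem abs_crossTerm_sub_le {k1 k2 ρ : ℝ} (hk1 : 1 ≤ k1)
    (h1 : ∀ e : Obs K, k1 ≤ K e.1.1 e.1.2) (h2 : ∀ e : Obs K, (K e.1.1 e.1.2 : ℝ) ≤ k2)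
    (hΛ : 0 ≤ lambdaMax (lossQ K)) (hρ : 0 ≤ ρ) {S S' : Matrix (Obs K) (Obs K) ℝ}
    (hS : ∀ v x : Obs K → ℝ, |v ⬝ᵥ (S *ᵥ x) - v ⬝ᵥ (S' *ᵥ x)| ≤
      ρ * (√(weightedSq K v) * √(weightedSq K x))) (u z : Obs K → ℝ) :
    |crossTerm K S u z - crossTerm K S' u z| ≤
      ρ * (lambdaMax (lossQ K) * √(k2 / k1)) * √((∑ e, u e ^ 2) * ∑ e, z e ^ 2) := by
  have hk0 : 0 < k1 := zero_lt_one.trans_le hk1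
  rw [crossTerm_eq, crossTerm_eq]
  refine (hS _ _).trans ?_
  rw [mul_assoc ρ]
  refine mul_le_mul_of_nonneg_left ?_ hρ
  have e1 : weightedSq K (covM K *ᵥ (lossQ K *ᵥ u)) ≤
      k1⁻¹ * (lambdaMax (lossQ K) ^ 2 * ∑ e, u e ^ 2) :=
    (weightedSq_covM_mulVec_le hk0 h1 _).trans
      (mul_le_mul_of_nonneg_left (lossQ_sq_le K u) (by positivity))
  have hu : 0 ≤ ∑ e, u e ^ 2 := Finset.sum_nonneg fun _ _ => sq_nonneg _
  have hz : 0 ≤ ∑ e, z e ^ 2 := Finset.sum_nonneg fun _ _ => sq_nonneg _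
  rw [← Real.sqrt_mul (weightedSq_nonneg _)]
  have e2 : lambdaMax (lossQ K) * √(k2 / k1) * √((∑ e, u e ^ 2) * ∑ e, z e ^ 2) =
      √((k1⁻¹ * (lambdaMax (lossQ K) ^ 2 * ∑ e, u e ^ 2)) * (k2 * ∑ e, z e ^ 2)) := by
    have : (k1⁻¹ * (lambdaMax (lossQ K) ^ 2 * ∑ e, u e ^ 2)) * (k2 * ∑ e, z e ^ 2) =
      lambdaMax (lossQ K) ^ 2 * (((∑ e, u e ^ 2) * ∑ e, z e ^ 2) * (k2 / k1)) := by
        rw [div_eq_mul_inv]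
        ring
    rw [this, Real.sqrt_mul (sq_nonneg _), Real.sqrt_sq hΛ,
      Real.sqrt_mul (mul_nonneg hu hz)]
    ring
  rw [e2]
  exact Real.sqrt_le_sqrt (mul_le_mul e1 (weightedSq_le h2 z) (weightedSq_nonneg _) (by positivity))

theorem abs_trace_sub_le {k1 k2 ρ : ℝ} (hk1 : 1 ≤ k1)
    (h1 : ∀ e : Obs K, k1 ≤ K e.1.1 e.1.2) (h2 : ∀ e : Obs K, (K e.1.1 e.1.2 : ℝ) ≤ k2)
    (hΛ : 0 ≤ lambdaMax (lossQ K)) (hρ : 0 ≤ ρ) {S S' : Matrix (Obs K) (Obs K) ℝ}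
    (hS : ∀ v x : Obs K → ℝ, |v ⬝ᵥ (S *ᵥ x) - v ⬝ᵥ (S' *ᵥ x)| ≤
      ρ * (√(weightedSq K v) * √(weightedSq K x))) :
    |(S * covM K * lossQ K * covM K).trace - (S' * covM K * lossQ K * covM K).trace| ≤
      ρ * (lambdaMax (lossQ K) * √(k2 / k1)) * (r * c) := by
  rw [trace_eq_sum_crossTerm, trace_eq_sum_crossTerm, ← Finset.sum_sub_distrib]
  refine (Finset.abs_sum_le_sum_abs _ _).trans ?_
  have hone : ∀ e : Obs K, |crossTerm K S (Pi.single e 1) (covM K *ᵥ Pi.single e 1) -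
      crossTerm K S' (Pi.single e 1) (covM K *ᵥ Pi.single e 1)| ≤
        ρ * (lambdaMax (lossQ K) * √(k2 / k1)) := fun e => by
    refine (abs_crossTerm_sub_le hk1 h1 h2 hΛ hρ hS _ _).trans
      (mul_le_of_le_one_right (by positivity) ?_)
    refine Real.sqrt_le_iff.2 ⟨zero_le_one, ?_⟩
    have h3 : ∑ f, (Pi.single e 1 : Obs K → ℝ) f ^ 2 = 1 := by
      simp [Pi.single_apply]
    have h4 : ∑ f, (covM K *ᵥ (Pi.single e 1 : Obs K → ℝ)) f ^ 2 =
        ((K e.1.1 e.1.2 : ℝ)⁻¹) ^ 2 := by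
      simp [covM, mulVec_diagonal, Pi.single_apply]
    rw [h3, h4, one_mul, one_pow]
    exact pow_le_one₀ (inv_nonneg.2 (Nat.cast_nonneg _)) (inv_le_one_of_one_le₀ (hk1.trans (h1 e)))
  refine (Finset.sum_le_sum fun e _ => hone e).trans ?_
  rw [Finset.sum_const, nsmul_eq_mul, mul_comm, Finset.card_univ]
  exact mul_le_mul_of_nonneg_left (card_obs_le K) (by positivity)

/-- On the event where the errors and finitely many bilinear forms in them are of their typical
size, `fluctuation` is small over the whole domain of the hyper-parameters. -/
theorem abs_fluctuation_le (hr : 0 < r) (hc : 0 < c) {k1 k2 ρ s σ τ δ B D : ℝ} (hk1 : 1 ≤ k1)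
    (h1 : ∀ e : Obs K, k1 ≤ K e.1.1 e.1.2) (h2 : ∀ e : Obs K, (K e.1.1 e.1.2 : ℝ) ≤ k2)
    (hΛ : 0 ≤ lambdaMax (lossQ K)) (hρ : 0 ≤ ρ) (hτ : τ ∈ Set.Ioc (0 : ℝ) 1) (hδ : 0 ≤ δ)
    (hD : 0 ≤ D) (hs : ρ * (lambdaMax (lossQ K) * √(k2 / k1)) ≤ s)
    {J : Type*} (g : J → ℝ × ℝ)
    (hg : ∀ lA lB, 0 ≤ lA → 0 ≤ lB → ∃ k, ∀ v x : Obs K → ℝ,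
        |v ⬝ᵥ ((sigmaMat K lA lB)⁻¹ *ᵥ x) - v ⬝ᵥ ((sigmaMat K (g k).1 (g k).2)⁻¹ *ᵥ x)| ≤
          ρ * (√(weightedSq K v) * √(weightedSq K x)))
    {η y : Obs K → ℝ} (hy : ∑ e, y e ^ 2 ≤ D ^ 2 * (r * c))
    (he : ∑ e, (y - η) e ^ 2 ≤ B * (r * c))
    (hq : ∀ k, |crossTerm K (sigmaMat K (g k).1 (g k).2)⁻¹ (y - η) (y - η) -
      σ ^ 2 * ((sigmaMat K (g k).1 (g k).2)⁻¹ * covM K * lossQ K * covM K).trace| ≤ δ * (r * c))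
    (hη : ∀ k, |crossTerm K (sigmaMat K (g k).1 (g k).2)⁻¹ (y - η) η| ≤ δ * (r * c))
    (h1' : ∀ k, |crossTerm K (sigmaMat K (g k).1 (g k).2)⁻¹ (y - η) (fun _ => 1)| ≤
      δ * √(r * c * Fintype.card (Obs K)))
    {h : Hyper} (hh : h ∈ hyperDomain K τ y) :
    |fluctuation K σ η y h| ≤
      δ * (2 + √(2 / τ) * D) + s * (√(B * (2 * D ^ 2 * (1 + 2 / τ))) + σ ^ 2) := by
  obtain ⟨m, l⟩ := h
  have hm := sq_mul_card_le_of_mem_quantile y hτ hh.1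
  have hτ0 := hτ.1
  change m ^ 2 * (τ / 2 * Fintype.card (Obs K)) ≤ _ at hm
  have hN : (0 : ℝ) < r * c := mul_pos (Nat.cast_pos.2 hr) (Nat.cast_pos.2 hc)
  generalize hNdef : (r : ℝ) * c = N at *
  have hs0 : 0 ≤ s := le_trans (by positivity) hs
  generalize hbdef : δ * (2 + √(2 / τ) * D) + s * (√(B * (2 * D ^ 2 * (1 + 2 / τ))) + σ ^ 2) = b
  have hmc : m ^ 2 * Fintype.card (Obs K) ≤ 2 / τ * (D ^ 2 * N) := by
    have : m ^ 2 * (Fintype.card (Obs K) : ℝ) =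
        2 / τ * (m ^ 2 * (τ / 2 * Fintype.card (Obs K))) := by
      field_simp
    rw [this]
    exact mul_le_mul_of_nonneg_left (hm.trans hy) (by positivity)
  have hz : ∑ e : Obs K, (y e - m) ^ 2 ≤ 2 * D ^ 2 * (1 + 2 / τ) * N := by
    have : ∑ e : Obs K, (y e - m) ^ 2 ≤ ∑ e : Obs K, (2 * y e ^ 2 + 2 * m ^ 2) := by
      refine Finset.sum_le_sum fun e _ => ?_
      nlinarith [sq_nonneg (y e + m)]
    rw [Finset.sum_add_distrib, ← Finset.mul_sum, Finset.sum_const, nsmul_eq_mul,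
      Finset.card_univ] at this
    linarith
  have hmT : ∀ k, |m * crossTerm K (sigmaMat K (g k).1 (g k).2)⁻¹ (y - η) (fun _ => 1)| ≤
      δ * (√(2 / τ) * D) * N := fun k => by
    rw [abs_mul]
    calc |m| * _ ≤ |m| * (δ * √(N * Fintype.card (Obs K))) :=
          mul_le_mul_of_nonneg_left (h1' k) (abs_nonneg m)
      _ = δ * √(m ^ 2 * Fintype.card (Obs K) * N) := by
          have : m ^ 2 * Fintype.card (Obs K) * N = m ^ 2 * (N * Fintype.card (Obs K)) := by ring
          rw [this, Real.sqrt_mul (sq_nonneg m), Real.sqrt_sq_eq_abs]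
          ring
      _ ≤ δ * √(2 / τ * (D ^ 2 * N) * N) := by
          refine mul_le_mul_of_nonneg_left (Real.sqrt_le_sqrt ?_) hδ
          exact mul_le_mul_of_nonneg_right hmc hN.le
      _ = δ * (√(2 / τ) * D) * N := by
          have : 2 / τ * (D ^ 2 * N) * N = 2 / τ * (D * N) ^ 2 := by ring
          rw [this, Real.sqrt_mul (by positivity), Real.sqrt_sq (by positivity)]
          ring
  have hclosed : IsClosed {S : Matrix (Obs K) (Obs K) ℝ |
      |N⁻¹ * (crossTerm K S (y - η) (y - fun _ => m)
        - σ ^ 2 * (S * covM K * lossQ K * covM K).trace)| ≤ b} :=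
    isClosed_le (continuous_const.mul ((continuous_crossTerm _ _).sub
      (continuous_const.mul continuous_trace_mul))).abs continuous_const
  have hfl : fluctuation K σ η y (m, l) = N⁻¹ * (crossTerm K (sigmaInv K l) (y - η)
      (y - fun _ => m) - σ ^ 2 * (sigmaInv K l * covM K * lossQ K * covM K).trace) := by
    rw [fluctuation, hNdef]
  rw [hfl]
  refine sigmaInv_induction K hclosed (fun lA lB hA hB => ?_) l
  obtain ⟨k, hk⟩ := hg lA lB hA hB
  rw [Set.mem_ofPred_eq, abs_mul, abs_of_pos (inv_pos.2 hN), inv_mul_le_iff₀ hN]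
  have c1 := abs_crossTerm_sub_le hk1 h1 h2 hΛ hρ hk (y - η) (y - fun _ => m)
  have c2 := abs_trace_sub_le hk1 h1 h2 hΛ hρ hk
  rw [hNdef] at c2
  have c3 : ρ * (lambdaMax (lossQ K) * √(k2 / k1)) *
      √((∑ e, (y - η) e ^ 2) * ∑ e : Obs K, (y e - m) ^ 2) ≤
        s * (√(B * (2 * D ^ 2 * (1 + 2 / τ))) * N) := by
    refine mul_le_mul hs ?_ (Real.sqrt_nonneg _) hs0
    have e0 : 0 ≤ ∑ e, (y - η) e ^ 2 := Finset.sum_nonneg fun _ _ => sq_nonneg _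
    have e1 : 0 ≤ ∑ e : Obs K, (y e - m) ^ 2 := Finset.sum_nonneg fun _ _ => sq_nonneg _
    calc √((∑ e, (y - η) e ^ 2) * ∑ e : Obs K, (y e - m) ^ 2)
        ≤ √((B * N) * (2 * D ^ 2 * (1 + 2 / τ) * N)) :=
          Real.sqrt_le_sqrt (mul_le_mul he hz e1 (e0.trans he))
      _ = √(N ^ 2 * (B * (2 * D ^ 2 * (1 + 2 / τ)))) := by
          congr 1
          ring
      _ = √(B * (2 * D ^ 2 * (1 + 2 / τ))) * N := by
          rw [Real.sqrt_mul (sq_nonneg N), Real.sqrt_sq hN.le, mul_comm]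
  have c4 : σ ^ 2 * (ρ * (lambdaMax (lossQ K) * √(k2 / k1)) * N) ≤ σ ^ 2 * (s * N) :=
    mul_le_mul_of_nonneg_left (mul_le_mul_of_nonneg_right hs hN.le) (sq_nonneg σ)
  have hsplit : crossTerm K (sigmaMat K (g k).1 (g k).2)⁻¹ (y - η) (y - fun _ => m) =
      crossTerm K (sigmaMat K (g k).1 (g k).2)⁻¹ (y - η) (y - η) +
      crossTerm K (sigmaMat K (g k).1 (g k).2)⁻¹ (y - η) η -
      m * crossTerm K (sigmaMat K (g k).1 (g k).2)⁻¹ (y - η) (fun _ => 1) := by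
    have e1 : (y - fun _ => m) = ((y - η) + η) + (-m) • (fun _ => (1 : ℝ)) := by
      ext e
      simp
      ring
    rw [e1, crossTerm_add, crossTerm_add, crossTerm_smul]
    ring
  have c5 : |σ ^ 2 * ((sigmaMat K lA lB)⁻¹ * covM K * lossQ K * covM K).trace -
      σ ^ 2 * ((sigmaMat K (g k).1 (g k).2)⁻¹ * covM K * lossQ K * covM K).trace| ≤
        σ ^ 2 * (s * N) := by
    rw [← mul_sub, abs_mul, abs_of_nonneg (sq_nonneg σ)]
    exact (mul_le_mul_of_nonneg_left c2 (sq_nonneg σ)).trans c4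
  have q1 := abs_le.1 (c1.trans c3)
  have q2 := abs_le.1 c5
  have q3 := abs_le.1 (hq k)
  have q4 := abs_le.1 (hη k)
  have q5 := abs_le.1 (hmT k)
  rw [hsplit] at q1
  have hb : N * b = δ * N + δ * N + δ * (√(2 / τ) * D) * N +
      s * (√(B * (2 * D ^ 2 * (1 + 2 / τ))) * N) + σ ^ 2 * (s * N) := by
    rw [← hbdef]
    ring
  rw [hb, abs_le]
  constructor <;> linarith [q1.1, q1.2, q2.1, q2.2, q3.1, q3.2, q4.1, q4.2, q5.1, q5.2]

end Fluctuation

/-! ### Stochastic bounds -/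

/-- Markov's inequality in the form used below. -/
theorem measure_lt_le {X : Type*} [MeasurableSpace X] {P : Measure X} [IsFiniteMeasure P]
    {f : X → ℝ} (hf0 : ∀ x, 0 ≤ f x) (hf : Integrable f P) {a b : ℝ} (ha : 0 < a)
    (hb : ∫ x, f x ∂P ≤ b) : P {x | a < f x} ≤ ENNReal.ofReal (b / a) := by
  have h1 := mul_meas_ge_le_integral_of_nonneg (Eventually.of_forall hf0) hf a
  have h2 : P {x | a < f x} ≤ P {x | a ≤ f x} := measure_mono fun x (hx : a < f x) => hx.le
  refine h2.trans ?_
  rw [← ofReal_measureReal]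
  refine ENNReal.ofReal_le_ofReal ?_
  rw [le_div_iff₀ ha]
  linarith

section Stochastic

variable {r c : ℕ} {K : Fin r → Fin c → ℕ}

theorem obsLaw_eq_gaussianPi (K : Fin r → Fin c → ℕ) (σ : ℝ) (η : Fin r × Fin c → ℝ) :
    obsLaw K σ η = gaussianPi (fun e : Obs K => η e.1)
      (fun e => Real.toNNReal (σ ^ 2 / (K e.1.1 e.1.2 : ℝ))) := rfl

instance (K : Fin r → Fin c → ℕ) (σ : ℝ) (η : Fin r × Fin c → ℝ) :
    IsProbabilityMeasure (obsLaw K σ η) := by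
  rw [obsLaw_eq_gaussianPi]
  infer_instance

theorem coe_variance (K : Fin r → Fin c → ℕ) (σ : ℝ) (e : Obs K) :
    (Real.toNNReal (σ ^ 2 / (K e.1.1 e.1.2 : ℝ)) : ℝ) = σ ^ 2 / (K e.1.1 e.1.2 : ℝ) :=
  Real.coe_toNNReal _ (by positivity)

theorem variance_le (K : Fin r → Fin c → ℕ) (σ : ℝ) (e : Obs K) :
    σ ^ 2 / (K e.1.1 e.1.2 : ℝ) ≤ σ ^ 2 :=
  div_le_self (sq_nonneg σ) (Nat.one_le_cast.2 e.2)

theorem sum_sq_lossQ_covM_inv_le {k1 k2 : ℝ} (hk1 : 1 ≤ k1)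
    (h1 : ∀ e : Obs K, k1 ≤ K e.1.1 e.1.2) (h2 : ∀ e : Obs K, (K e.1.1 e.1.2 : ℝ) ≤ k2)
    {lA lB : ℝ} (hA : 0 ≤ lA) (hB : 0 ≤ lB) (x : Obs K → ℝ) :
    ∑ e, (lossQ K *ᵥ (covM K *ᵥ ((sigmaMat K lA lB)⁻¹ *ᵥ x))) e ^ 2 ≤
      lambdaMax (lossQ K) ^ 2 * (k2 / k1) * ∑ e, x e ^ 2 := by
  have hk0 : 0 < k1 := zero_lt_one.trans_le hk1
  refine (lossQ_sq_le K _).trans ?_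
  rw [mul_assoc]
  refine mul_le_mul_of_nonneg_left ?_ (sq_nonneg _)
  have e1 := sum_sigmaMat_inv_mulVec_sq_le hA hB x
  have e2 := weightedSq_le h2 x
  set u := (sigmaMat K lA lB)⁻¹ *ᵥ x
  calc ∑ e, (covM K *ᵥ u) e ^ 2
      ≤ ∑ e : Obs K, k1⁻¹ * (((K e.1.1 e.1.2 : ℕ) : ℝ)⁻¹ * u e ^ 2) := by
        refine Finset.sum_le_sum fun e _ => ?_
        rw [covM, mulVec_diagonal, mul_pow, sq, mul_assoc]
        refine mul_le_mul_of_nonneg_right (inv_anti₀ hk0 (h1 e)) ?_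
        exact mul_nonneg (inv_nonneg.2 (Nat.cast_nonneg _)) (sq_nonneg _)
    _ = k1⁻¹ * ∑ e : Obs K, ((K e.1.1 e.1.2 : ℕ) : ℝ)⁻¹ * u e ^ 2 := by rw [Finset.mul_sum]
    _ ≤ k1⁻¹ * (k2 * ∑ e, x e ^ 2) :=
        mul_le_mul_of_nonneg_left (e1.trans e2) (inv_nonneg.2 hk0.le)
    _ = k2 / k1 * ∑ e, x e ^ 2 := by
        rw [div_eq_mul_inv]
        ring

theorem crossTerm_eq_sum (S : Matrix (Obs K) (Obs K) ℝ) (u z : Obs K → ℝ) :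
    crossTerm K S u z = ∑ e, (lossQ K *ᵥ (covM K *ᵥ (S *ᵥ z))) e * u e := by
  rw [crossTerm, dotProduct_comm, dotProduct]

theorem integrable_crossTerm_sq (σ : ℝ) (η : Fin r × Fin c → ℝ)
    (S : Matrix (Obs K) (Obs K) ℝ) (z : Obs K → ℝ) :
    Integrable (fun y => crossTerm K S (y - fun e => η e.1) z ^ 2) (obsLaw K σ η) := by
  simp only [crossTerm_eq_sum, Pi.sub_apply]
  exact integrable_linear_sq _ _ _

theorem integral_crossTerm_sq_le {k1 k2 : ℝ} (hk1 : 1 ≤ k1)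
    (h1 : ∀ e : Obs K, k1 ≤ K e.1.1 e.1.2) (h2 : ∀ e : Obs K, (K e.1.1 e.1.2 : ℝ) ≤ k2)
    {lA lB : ℝ} (hA : 0 ≤ lA) (hB : 0 ≤ lB) (σ : ℝ) (η : Fin r × Fin c → ℝ) (z : Obs K → ℝ) :
    ∫ y, crossTerm K (sigmaMat K lA lB)⁻¹ (y - fun e => η e.1) z ^ 2 ∂obsLaw K σ η ≤
      σ ^ 2 * (lambdaMax (lossQ K) ^ 2 * (k2 / k1) * ∑ e, z e ^ 2) := by
  simp only [crossTerm_eq_sum, Pi.sub_apply, obsLaw_eq_gaussianPi]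
  rw [integral_linear_sq]
  refine le_trans ?_ (mul_le_mul_of_nonneg_left
    (sum_sq_lossQ_covM_inv_le hk1 h1 h2 hA hB z) (sq_nonneg σ))
  rw [Finset.mul_sum]
  refine Finset.sum_le_sum fun e _ => ?_
  rw [coe_variance, mul_comm]
  exact mul_le_mul_of_nonneg_right (variance_le K σ e) (sq_nonneg _)

theorem crossTerm_sub_trace_eq (S : Matrix (Obs K) (Obs K) ℝ) (σ : ℝ) (u : Obs K → ℝ) :
    crossTerm K S u u - σ ^ 2 * (S * covM K * lossQ K * covM K).trace =
      ∑ e, ∑ f, (lossQ K * covM K * S) e f * (u e * u f) -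
        ∑ e, (lossQ K * covM K * S) e e *
          (Real.toNNReal (σ ^ 2 / (K e.1.1 e.1.2 : ℝ)) : ℝ) := by
  congr 1
  · rw [crossTerm, mulVec_mulVec, mulVec_mulVec, dotProduct]
    refine Finset.sum_congr rfl fun e _ => ?_
    rw [mulVec, dotProduct, Finset.mul_sum]
    exact Finset.sum_congr rfl fun f _ => by ring
  · have h : (S * covM K * lossQ K * covM K).trace = (lossQ K * covM K * S * covM K).trace := by
      rw [Matrix.mul_assoc, trace_mul_comm]
      simp only [Matrix.mul_assoc]
    rw [h, trace, Finset.mul_sum]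
    refine Finset.sum_congr rfl fun e _ => ?_
    rw [coe_variance, diag_apply, covM, mul_diagonal]
    ring

theorem integrable_quadratic_crossTerm_sq (σ : ℝ) (η : Fin r × Fin c → ℝ)
    (S : Matrix (Obs K) (Obs K) ℝ) :
    Integrable (fun y => (crossTerm K S (y - fun e => η e.1) (y - fun e => η e.1) -
      σ ^ 2 * (S * covM K * lossQ K * covM K).trace) ^ 2) (obsLaw K σ η) := by
  simp only [crossTerm_sub_trace_eq, Pi.sub_apply]
  exact integrable_quadratic_sq _ _ fun e f => (lossQ K * covM K * S) e f

theorem integral_quadratic_crossTerm_sq_le {k1 k2 : ℝ} (hk1 : 1 ≤ k1)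
    (h1 : ∀ e : Obs K, k1 ≤ K e.1.1 e.1.2) (h2 : ∀ e : Obs K, (K e.1.1 e.1.2 : ℝ) ≤ k2)
    (hk2 : 0 ≤ k2) {lA lB : ℝ} (hA : 0 ≤ lA) (hB : 0 ≤ lB) (σ : ℝ) (η : Fin r × Fin c → ℝ) :
    ∫ y, (crossTerm K (sigmaMat K lA lB)⁻¹ (y - fun e => η e.1) (y - fun e => η e.1) -
      σ ^ 2 * ((sigmaMat K lA lB)⁻¹ * covM K * lossQ K * covM K).trace) ^ 2 ∂obsLaw K σ η ≤
      (2 + gaussianFourth) * (σ ^ 4 * (lambdaMax (lossQ K) ^ 2 * (k2 / k1)) * (r * c)) := by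
  simp only [crossTerm_sub_trace_eq, Pi.sub_apply]
  refine (integral_quadratic_sq_le _ _
    fun e f => (lossQ K * covM K * (sigmaMat K lA lB)⁻¹) e f).trans ?_
  refine mul_le_mul_of_nonneg_left ?_ (by linarith [gaussianFourth_nonneg])
  rw [Finset.sum_comm]
  have hcol : ∀ f : Obs K, ∑ e, (lossQ K * covM K * (sigmaMat K lA lB)⁻¹) e f ^ 2 ≤
      lambdaMax (lossQ K) ^ 2 * (k2 / k1) := fun f => by
    have h := sum_sq_lossQ_covM_inv_le hk1 h1 h2 hA hB (Pi.single f 1)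
    have h3 : ∑ e, (Pi.single f 1 : Obs K → ℝ) e ^ 2 = 1 := by
      simp [Pi.single_apply]
    have h4 : lossQ K *ᵥ (covM K *ᵥ ((sigmaMat K lA lB)⁻¹ *ᵥ Pi.single f 1)) =
        (lossQ K * covM K * (sigmaMat K lA lB)⁻¹).col f := by
      rw [mulVec_mulVec, mulVec_mulVec, mulVec_single_one]
    rw [h3, mul_one, h4] at h
    exact h
  have hk0 : 0 < k1 := zero_lt_one.trans_le hk1
  calc _ ≤ ∑ _f : Obs K, σ ^ 4 * (lambdaMax (lossQ K) ^ 2 * (k2 / k1)) := by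
        refine Finset.sum_le_sum fun f _ => ?_
        refine le_trans ?_ (mul_le_mul_of_nonneg_left (hcol f) (by positivity))
        rw [Finset.mul_sum]
        refine Finset.sum_le_sum fun e _ => ?_
        rw [coe_variance, coe_variance, mul_comm]
        refine mul_le_mul_of_nonneg_right ?_ (sq_nonneg _)
        calc _ ≤ σ ^ 2 * σ ^ 2 := mul_le_mul (variance_le K σ e) (variance_le K σ f)
              (by positivity) (sq_nonneg σ)
          _ = σ ^ 4 := by ring
    _ ≤ _ := by
        rw [Finset.sum_const, nsmul_eq_mul, mul_comm, Finset.card_univ]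
        exact mul_le_mul_of_nonneg_left (card_obs_le K) (by positivity)

theorem integrable_error_sq (σ : ℝ) (η : Fin r × Fin c → ℝ) (e : Obs K) :
    Integrable (fun y => (y e - η e.1) ^ 2) (obsLaw K σ η) := by
  have h := integrable_two (fun e : Obs K => η e.1)
    (fun e => Real.toNNReal (σ ^ 2 / (K e.1.1 e.1.2 : ℝ))) e e
  simp only [← sq] at h
  exact h

theorem integral_sum_error_sq_le (σ : ℝ) (η : Fin r × Fin c → ℝ) :
    ∫ y, ∑ e : Obs K, (y e - η e.1) ^ 2 ∂obsLaw K σ η ≤ σ ^ 2 * (r * c) := by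
  rw [integral_finsetSum _ fun e _ => integrable_error_sq σ η e]
  have h : ∀ e : Obs K, ∫ y, (y e - η e.1) ^ 2 ∂obsLaw K σ η ≤ σ ^ 2 := fun e => by
    have := integral_two (fun e : Obs K => η e.1)
      (fun e => Real.toNNReal (σ ^ 2 / (K e.1.1 e.1.2 : ℝ))) e e
    simp only [← sq, if_true, coe_variance] at this
    rw [obsLaw_eq_gaussianPi, this]
    exact variance_le K σ e
  refine (Finset.sum_le_sum fun e _ => h e).trans ?_
  rw [Finset.sum_const, nsmul_eq_mul, mul_comm, Finset.card_univ]
  exact mul_le_mul_of_nonneg_left (card_obs_le K) (sq_nonneg σ)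

/-- The probability that `fluctuation` is large somewhere on the domain of the hyper-parameters:
Markov's inequality for the errors, and a union bound with Chebyshev's inequality over the
`n ^ 2` points of the net. -/
theorem obsLaw_exists_fluctuation_le (hK : Estimable K) (hr : 0 < r) (hc : 0 < c)
    {k1 k2 s σ τ δ B C : ℝ} (hk1 : 1 ≤ k1)
    (h1 : ∀ e : Obs K, k1 ≤ K e.1.1 e.1.2) (h2 : ∀ e : Obs K, (K e.1.1 e.1.2 : ℝ) ≤ k2)
    (hτ : τ ∈ Set.Ioc (0 : ℝ) 1) (hδ : 0 < δ) (hB : 0 < B) (hC : 0 ≤ C) {n : ℕ} (hn : 0 < n)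
    (hs : 8 * √(lambdaMax (lossQ K) * (k2 / k1)) / n * (lambdaMax (lossQ K) * √(k2 / k1)) ≤ s)
    {η : Fin r × Fin c → ℝ} (hη : ∑ e : Obs K, η e.1 ^ 2 ≤ C * (r * c)) :
    obsLaw K σ η {y | ∃ h ∈ hyperDomain K τ y,
      δ * (2 + √(2 / τ) * √(2 * (B + C))) +
        s * (√(B * (2 * √(2 * (B + C)) ^ 2 * (1 + 2 / τ))) + σ ^ 2) <
          |fluctuation K σ (fun e => η e.1) y h|} ≤
      ENNReal.ofReal (σ ^ 2 / B + n ^ 2 * (lambdaMax (lossQ K) ^ 2 * (k2 / k1)) / (r * c) *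
        (((2 + gaussianFourth) * σ ^ 4 + σ ^ 2 * C + σ ^ 2) / δ ^ 2)) := by
  have hE := nonempty_obs hK hr hc
  obtain ⟨e0⟩ := hE
  have hk0 : 0 < k1 := zero_lt_one.trans_le hk1
  have hk2 : 0 < k2 := hk0.trans_le ((h1 e0).trans (h2 e0))
  have hΛ : 0 ≤ lambdaMax (lossQ K) := zero_le_one.trans (one_le_lambdaMax_lossQ hK hr hc)
  obtain ⟨g, g0, hg⟩ := exists_net hK hr hc hk0 h1 h2 hn
  have hN : (0 : ℝ) < r * c := mul_pos (Nat.cast_pos.2 hr) (Nat.cast_pos.2 hc)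
  have hcard : (0 : ℝ) < Fintype.card (Obs K) := Nat.cast_pos.2 (Fintype.card_pos_iff.2 ⟨e0⟩)
  set V := lambdaMax (lossQ K) ^ 2 * (k2 / k1) with hV
  have hV0 : 0 ≤ V := by positivity
  set P := obsLaw K σ η
  set S : Fin n × Fin n → Matrix (Obs K) (Obs K) ℝ := fun k => (sigmaMat K (g k).1 (g k).2)⁻¹
  set E0 : Set (Obs K → ℝ) := {y | B * (r * c) < ∑ e : Obs K, (y e - η e.1) ^ 2}
  set E1 : Fin n × Fin n → Set (Obs K → ℝ) := fun k =>
    {y | (δ * (r * c)) ^ 2 < (crossTerm K (S k) (y - fun e => η e.1) (y - fun e => η e.1) -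
      σ ^ 2 * (S k * covM K * lossQ K * covM K).trace) ^ 2}
  set E2 : Fin n × Fin n → Set (Obs K → ℝ) := fun k =>
    {y | (δ * (r * c)) ^ 2 < crossTerm K (S k) (y - fun e => η e.1) (fun e => η e.1) ^ 2}
  set E3 : Fin n × Fin n → Set (Obs K → ℝ) := fun k =>
    {y | δ ^ 2 * (r * c * Fintype.card (Obs K)) <
      crossTerm K (S k) (y - fun e => η e.1) (fun _ => 1) ^ 2}
  have p0 : P E0 ≤ ENNReal.ofReal (σ ^ 2 / B) := by
    refine (measure_lt_le (fun y => Finset.sum_nonneg fun e _ => sq_nonneg _)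
      (integrable_finsetSum _ fun e _ => integrable_error_sq σ η e) (by positivity)
      (integral_sum_error_sq_le σ η)).trans_eq ?_
    rw [mul_div_mul_right _ _ hN.ne']
  have p1 : ∀ k, P (E1 k) ≤
      ENNReal.ofReal (V / (r * c) * ((2 + gaussianFourth) * σ ^ 4 / δ ^ 2)) := fun k => by
    refine (measure_lt_le (fun y => sq_nonneg _) (integrable_quadratic_crossTerm_sq σ η (S k))
      (by positivity) (integral_quadratic_crossTerm_sq_le hk1 h1 h2 hk2.le (g0 k).1 (g0 k).2
        σ η)).trans_eq ?_
    congr 1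
    rw [← hV]
    field_simp
  have p2 : ∀ k, P (E2 k) ≤ ENNReal.ofReal (V / (r * c) * (σ ^ 2 * C / δ ^ 2)) := fun k => by
    have hi := (integral_crossTerm_sq_le hk1 h1 h2 (g0 k).1 (g0 k).2 σ η
      (fun e => η e.1)).trans (mul_le_mul_of_nonneg_left
        (mul_le_mul_of_nonneg_left hη hV0) (sq_nonneg σ))
    rw [← hV] at hi
    refine (measure_lt_le (fun y => sq_nonneg _) (integrable_crossTerm_sq σ η (S k) _)
      (by positivity) hi).trans_eq ?_
    congr 1
    field_simp
  have p3 : ∀ k, P (E3 k) ≤ ENNReal.ofReal (V / (r * c) * (σ ^ 2 / δ ^ 2)) := fun k => by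
    have hi := integral_crossTerm_sq_le hk1 h1 h2 (g0 k).1 (g0 k).2 σ η (fun _ => 1)
    rw [← hV] at hi
    refine (measure_lt_le (fun y => sq_nonneg _) (integrable_crossTerm_sq σ η (S k) _)
      (by positivity) hi).trans_eq ?_
    congr 1
    simp only [one_pow, Finset.sum_const, Finset.card_univ, nsmul_eq_mul, mul_one]
    field_simp
  have hsub : {y | ∃ h ∈ hyperDomain K τ y,
      δ * (2 + √(2 / τ) * √(2 * (B + C))) +
        s * (√(B * (2 * √(2 * (B + C)) ^ 2 * (1 + 2 / τ))) + σ ^ 2) <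
          |fluctuation K σ (fun e => η e.1) y h|} ⊆ E0 ∪ ⋃ k, (E1 k ∪ (E2 k ∪ E3 k)) := by
    rintro y ⟨h, hh, hlt⟩
    by_contra hy
    simp only [Set.mem_union, Set.mem_iUnion, not_or, not_exists] at hy
    obtain ⟨n0, n1⟩ := hy
    have m0 : ∑ e : Obs K, (y e - η e.1) ^ 2 ≤ B * (r * c) := not_lt.1 n0
    refine absurd hlt (not_lt.2 ?_)
    refine abs_fluctuation_le hr hc hk1 h1 h2 hΛ (by positivity) hτ hδ.le (Real.sqrt_nonneg _) hs g
      hg ?_ m0 (fun k => ?_) (fun k => ?_) (fun k => ?_) hh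
    · rw [Real.sq_sqrt (by positivity)]
      have : ∑ e, y e ^ 2 ≤ ∑ e : Obs K, (2 * (y e - η e.1) ^ 2 + 2 * η e.1 ^ 2) := by
        refine Finset.sum_le_sum fun e _ => ?_
        nlinarith [sq_nonneg (y e - 2 * η e.1)]
      rw [Finset.sum_add_distrib, ← Finset.mul_sum, ← Finset.mul_sum] at this
      linarith
    · exact abs_le_of_sq_le_sq (not_lt.1 (n1 k).1) (by positivity)
    · exact abs_le_of_sq_le_sq (not_lt.1 (n1 k).2.1) (by positivity)
    · refine abs_le_of_sq_le_sq ?_ (by positivity)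
      rw [mul_pow, Real.sq_sqrt (by positivity)]
      exact not_lt.1 (n1 k).2.2
  have hκ := gaussianFourth_nonneg
  set q1 := V / (r * c) * ((2 + gaussianFourth) * σ ^ 4 / δ ^ 2)
  set q2 := V / (r * c) * (σ ^ 2 * C / δ ^ 2)
  set q3 := V / (r * c) * (σ ^ 2 / δ ^ 2)
  have hq1 : 0 ≤ q1 := by positivity
  have hq2 : 0 ≤ q2 := by positivity
  have hq3 : 0 ≤ q3 := by positivity
  calc _ ≤ P (E0 ∪ ⋃ k, (E1 k ∪ (E2 k ∪ E3 k))) := measure_mono hsub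
    _ ≤ P E0 + ∑ k, P (E1 k ∪ (E2 k ∪ E3 k)) :=
        (measure_union_le _ _).trans (add_le_add le_rfl (measure_iUnion_fintype_le _ _))
    _ ≤ ENNReal.ofReal (σ ^ 2 / B) + ∑ _k : Fin n × Fin n, ENNReal.ofReal (q1 + (q2 + q3)) := by
        refine add_le_add p0 (Finset.sum_le_sum fun k _ => ?_)
        rw [ENNReal.ofReal_add hq1 (by positivity), ENNReal.ofReal_add hq2 hq3]
        exact (measure_union_le _ _).trans (add_le_add (p1 k)
          ((measure_union_le _ _).trans (add_le_add (p2 k) (p3 k))))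
    _ = ENNReal.ofReal (σ ^ 2 / B + n ^ 2 * (q1 + (q2 + q3))) := by
        have hq : 0 ≤ q1 + (q2 + q3) := by linarith
        rw [← ENNReal.ofReal_sum_of_nonneg fun _ _ => hq, ← ENNReal.ofReal_add (by positivity)
          (Finset.sum_nonneg fun _ _ => hq), Finset.sum_const, Finset.card_univ,
          Fintype.card_prod, Fintype.card_fin, nsmul_eq_mul, Nat.cast_mul, sq (n : ℝ)]
    _ = _ := by
        congr 1
        ring

end Stochastic

/-! ### The limit -/

/-- With `n = ⌈N ^ (1 / 4)⌉` both the mesh of the net and the union bound over it are negligible. -/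
theorem mesh_bounds {L ν N θ : ℝ} (hL : 1 ≤ L) (hν : 1 ≤ ν) (hN : 1 ≤ N)
    (h : L * ν ≤ θ * N ^ (1 / 8 : ℝ)) :
    ∃ n : ℕ, 0 < n ∧ 8 * √(L * ν) / n * (L * √ν) ≤ 8 * θ ^ 2 ∧
      n ^ 2 * (L ^ 2 * ν) / N ≤ 4 * θ ^ 2 := by
  set m := N ^ (1 / 8 : ℝ) with hm
  have hm1 : 1 ≤ m := Real.one_le_rpow hN (by norm_num)
  have hm8 : m ^ 8 = N := by
    rw [hm, ← Real.rpow_natCast, ← Real.rpow_mul (by linarith)]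
    norm_num
  have hLν : 0 < L * ν := by positivity
  have hsq : (L * ν) ^ 2 ≤ (θ * m) ^ 2 := pow_le_pow_left₀ hLν.le h 2
  have hn1 : m ^ 2 ≤ ⌈m ^ 2⌉₊ := Nat.le_ceil _
  have hm2 : 1 ≤ m ^ 2 := one_le_pow₀ hm1
  have hn2 : (⌈m ^ 2⌉₊ : ℝ) ≤ 2 * m ^ 2 := by
    have := Nat.ceil_lt_add_one (sq_nonneg m)
    linarith
  refine ⟨⌈m ^ 2⌉₊, Nat.ceil_pos.2 (by linarith), ?_, ?_⟩
  · have hn0 : (0 : ℝ) < ⌈m ^ 2⌉₊ := by linarith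
    have e1 : √(L * ν) * (L * √ν) ≤ (L * ν) ^ 2 := by
      have s1 : √L ≤ L := by
        rw [Real.sqrt_le_left (by linarith)]
        nlinarith
      have s2 : √(L * ν) * (L * √ν) = √L * (L * ν) := by
        rw [Real.sqrt_mul (by linarith)]
        linear_combination (√L * L) * Real.mul_self_sqrt (show 0 ≤ ν by linarith)
      rw [s2, sq]
      refine mul_le_mul_of_nonneg_right (s1.trans ?_) hLν.le
      nlinarith
    rw [div_mul_eq_mul_div, div_le_iff₀ hn0]
    have e2 : (θ * m) ^ 2 ≤ θ ^ 2 * ⌈m ^ 2⌉₊ := by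
      rw [mul_pow]
      exact mul_le_mul_of_nonneg_left hn1 (sq_nonneg θ)
    nlinarith
  · have e1 : L ^ 2 * ν ≤ (θ * m) ^ 2 := by
      refine le_trans ?_ hsq
      rw [mul_pow]
      exact mul_le_mul_of_nonneg_left (by nlinarith) (sq_nonneg L)
    have e2 : (⌈m ^ 2⌉₊ : ℝ) ^ 2 ≤ (2 * m ^ 2) ^ 2 := pow_le_pow_left₀ (Nat.cast_nonneg _) hn2 2
    rw [div_le_iff₀ (by linarith), ← hm8]
    calc (⌈m ^ 2⌉₊ : ℝ) ^ 2 * (L ^ 2 * ν) ≤ (2 * m ^ 2) ^ 2 * (θ * m) ^ 2 :=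
          mul_le_mul e2 e1 (by positivity) (by positivity)
      _ = 4 * θ ^ 2 * (m ^ 6 * 1) := by ring
      _ ≤ 4 * θ ^ 2 * (m ^ 6 * m ^ 2) := by gcongr
      _ = 4 * θ ^ 2 * m ^ 8 := by ring

/-- The loss of the tuning by `ure` exceeds the optimal one at most by the fluctuations. -/
theorem loss_sub_loss_le {r c : ℕ} {K : Fin r → Fin c → ℕ} (hK : Estimable K) {σ τ : ℝ} (μ : ℝ)
    (α : Fin r → ℝ) (β : Fin c → ℝ) {y : Obs K → ℝ} {h h' : Hyper}
    (hh : IsURETuning K σ τ y h) (hh' : h' ∈ hyperDomain K τ y) :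
    loss (cellMean μ α β) (cellEstimator K h y) - loss (cellMean μ α β) (cellEstimator K h' y) ≤
      2 * |fluctuation K σ (fun e => cellMean μ α β e.1) y h| +
        2 * |fluctuation K σ (fun e => cellMean μ α β e.1) y h'| := by
  have e1 := loss_sub_ure hK σ μ α β y h
  have e2 := loss_sub_ure hK σ μ α β y h'
  have e3 := isMinOn_iff.1 hh.2 h' hh'
  have e4 := neg_abs_le (fluctuation K σ (fun e => cellMean μ α β e.1) y h)
  have e5 := le_abs_self (fluctuation K σ (fun e => cellMean μ α β e.1) y h')
  linarith

end TwoWay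

theorem mainTheorem2
    -- known noise level, and the quantile level of the range of the location hyper-parameter
    (σ : ℝ) (hσ : 0 < σ) (τ : ℝ) (hτ : τ ∈ Set.Ioc (0 : ℝ) 1)
    -- for all `r`, `c`: a design with possibly missing cells and the parameters of the model
    (K : ∀ r c : ℕ, Fin r → Fin c → ℕ) (hK : ∀ r c, Estimable (K r c))
    (μ : ℕ → ℕ → ℝ) (α : ∀ r _c : ℕ, Fin r → ℝ) (β : ∀ _r c : ℕ, Fin c → ℝ)
    -- second moment condition on the parameter space
    (hA1 : ∃ C : ℝ, ∀ᶠ p : ℕ × ℕ in atTop ×ˢ atTop,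
      ((p.1 : ℝ) * (p.2 : ℝ))⁻¹ *
        ∑ e : Obs (K p.1 p.2),
          cellMean (μ p.1 p.2) (α p.1 p.2) (β p.1 p.2) e.1 ^ 2 ≤ C)
    -- condition on the design
    (hA2 : Tendsto (fun p : ℕ × ℕ =>
      ((p.1 : ℝ) * (p.2 : ℝ)) ^ (-(1 / 8) : ℝ) * Real.log ((p.1 : ℝ) * (p.2 : ℝ)) ^ 2 *
        imbalance (K p.1 p.2) * lambdaMax (lossQ (K p.1 p.2))) (atTop ×ˢ atTop) (𝓝 0))
    -- any choice of the tuning parameters minimizing the risk estimate, resp. the actual loss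
    (tuneU : ∀ r c : ℕ, (Obs (K r c) → ℝ) → Hyper)
    (isURE : ∀ r c y, IsURETuning (K r c) σ τ y (tuneU r c y))
    (tuneO : ∀ r c : ℕ, (Obs (K r c) → ℝ) → Hyper)
    (isOracle : ∀ r c y,
      IsOracleTuning (K r c) τ (cellMean (μ r c) (α r c) (β r c)) y (tuneO r c y))
    (ε : ℝ) (hε : 0 < ε) :
    Tendsto (fun p : ℕ × ℕ =>
      obsLaw (K p.1 p.2) σ (cellMean (μ p.1 p.2) (α p.1 p.2) (β p.1 p.2))
        {y | loss (cellMean (μ p.1 p.2) (α p.1 p.2) (β p.1 p.2))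
                (cellEstimator (K p.1 p.2) (tuneU p.1 p.2 y) y) ≥
              loss (cellMean (μ p.1 p.2) (α p.1 p.2) (β p.1 p.2))
                (cellEstimator (K p.1 p.2) (tuneO p.1 p.2 y) y) + ε})
      (atTop ×ˢ atTop) (𝓝 0) := by
  obtain ⟨C0, hC0⟩ := hA1
  rw [ENNReal.tendsto_nhds_zero]
  intro a ha
  rcases eq_or_ne a ⊤ with rfl | hatop
  · exact Eventually.of_forall fun _ => le_top
  have ha' : 0 < a.toReal := ENNReal.toReal_pos ha.ne' hatop
  have hτ0 := hτ.1
  set C := |C0|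
  have hCnn : 0 ≤ C := abs_nonneg _
  -- `B` makes Markov's inequality for the errors contribute at most `a / 2`.
  set B := 2 * (σ ^ 2 + 1) / a.toReal with hB
  have hB0 : 0 < B := by positivity
  set b1 := 2 + √(2 / τ) * √(2 * (B + C)) with hb1
  have hb1pos : 0 < b1 := by positivity
  set b2 := √(B * (2 * √(2 * (B + C)) ^ 2 * (1 + 2 / τ))) + σ ^ 2 with hb2
  have hb2nn : 0 ≤ b2 := by positivity
  -- `δ` and `θ` are chosen so that the two terms of the bound on the fluctuation, `δ * b1` and
  -- `8 * θ ^ 2 * b2`, are at most `ε / 16`, and the union bound contributes at most `a / 2`.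
  set δ := ε / (16 * b1) with hδ
  have hδ0 : 0 < δ := by positivity
  set c3 := ((2 + gaussianFourth) * σ ^ 4 + σ ^ 2 * C + σ ^ 2) / δ ^ 2 with hc3
  have hc3nn : 0 ≤ c3 := by
    have := gaussianFourth_nonneg
    positivity
  obtain ⟨θ, hθ0, hθ1, hθ2⟩ : ∃ θ : ℝ, 0 < θ ∧ 4 * θ ^ 2 * c3 ≤ a.toReal / 2 ∧
      8 * θ ^ 2 * b2 ≤ ε / 16 := by
    set x := min (a.toReal / (8 * (c3 + 1))) (ε / (128 * (b2 + 1)))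
    have hx0 : 0 < x := by positivity
    have x1 : x * (8 * (c3 + 1)) ≤ a.toReal := (le_div_iff₀ (by positivity)).1 (min_le_left _ _)
    have x2 : x * (128 * (b2 + 1)) ≤ ε := (le_div_iff₀ (by positivity)).1 (min_le_right _ _)
    refine ⟨√x, Real.sqrt_pos.2 hx0, ?_, ?_⟩ <;> rw [Real.sq_sqrt hx0.le] <;> nlinarith
  have hbig : ∀ᶠ p : ℕ × ℕ in atTop ×ˢ atTop, 3 ≤ p.1 ∧ 1 ≤ p.2 :=
    (eventually_ge_atTop 3).prod_mk (eventually_ge_atTop 1)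
  filter_upwards [hbig, hC0, hA2.eventually (gt_mem_nhds hθ0)] with p hp hpC hpθ
  obtain ⟨r, c⟩ := p
  simp only at hp hpC hpθ ⊢
  have hr : 0 < r := by omega
  have hc : 0 < c := by omega
  have hN3 : (3 : ℝ) ≤ r * c := by
    have h1 : (3 : ℝ) ≤ r := by exact_mod_cast hp.1
    have h2 : (1 : ℝ) ≤ c := by exact_mod_cast hp.2
    nlinarith
  have hN : (0 : ℝ) < r * c := by linarith
  have hE := nonempty_obs (hK r c) hr hc
  set k1 : ℝ := ⨅ e : Obs (K r c), (K r c e.1.1 e.1.2 : ℝ)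
  set k2 : ℝ := ⨆ e : Obs (K r c), (K r c e.1.1 e.1.2 : ℝ)
  have hk1 : 1 ≤ k1 := le_ciInf fun e => Nat.one_le_cast.2 e.2
  have h1 : ∀ e : Obs (K r c), k1 ≤ K r c e.1.1 e.1.2 := fun e =>
    ciInf_le (Set.finite_range _).bddBelow e
  have h2 : ∀ e : Obs (K r c), (K r c e.1.1 e.1.2 : ℝ) ≤ k2 := fun e =>
    le_ciSup (f := fun e : Obs (K r c) => (K r c e.1.1 e.1.2 : ℝ)) (Set.finite_range _).bddAbove e
  have hL := one_le_lambdaMax_lossQ (hK r c) hr hc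
  have hν : 1 ≤ k2 / k1 := by
    obtain ⟨e⟩ := hE
    rw [one_le_div (by linarith)]
    exact (h1 e).trans (h2 e)
  have hq : lambdaMax (lossQ (K r c)) * (k2 / k1) ≤ θ * ((r : ℝ) * c) ^ (1 / 8 : ℝ) := by
    -- Of the squared logarithm in the design condition only a lower bound is needed.
    have hlog : 1 ≤ Real.log ((r : ℝ) * c) ^ 2 := by
      refine one_le_pow₀ ?_
      rw [Real.le_log_iff_exp_le hN]
      exact (Real.exp_one_lt_d9.le.trans (by norm_num)).trans hN3
    have hpow : 0 < ((r : ℝ) * c) ^ (1 / 8 : ℝ) := Real.rpow_pos_of_pos hN _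
    have himb : imbalance (K r c) = k2 / k1 := rfl
    rw [himb, Real.rpow_neg hN.le] at hpθ
    set L := lambdaMax (lossQ (K r c))
    set ν := k2 / k1
    have hLν : 0 < L * ν := by positivity
    calc L * ν ≤ Real.log ((r : ℝ) * c) ^ 2 * (L * ν) := le_mul_of_one_le_left hLν.le hlog
      _ = ((((r : ℝ) * c) ^ (1 / 8 : ℝ))⁻¹ * Real.log ((r : ℝ) * c) ^ 2 * ν * L) *
          ((r : ℝ) * c) ^ (1 / 8 : ℝ) := by
            field_simp
      _ ≤ _ := mul_le_mul_of_nonneg_right hpθ.le hpow.le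
  obtain ⟨n, hn, hn1, hn2⟩ := mesh_bounds hL hν (by linarith) hq
  have hη : ∑ e : Obs (K r c), cellMean (μ r c) (α r c) (β r c) e.1 ^ 2 ≤ C * (r * c) := by
    rw [inv_mul_le_iff₀ hN] at hpC
    have := mul_le_mul_of_nonneg_left (le_abs_self C0) hN.le
    linarith
  have hmain := obsLaw_exists_fluctuation_le (σ := σ) (hK r c) hr hc hk1 h1 h2 hτ hδ0 hB0 hCnn hn
    hn1 hη
  rw [← hb1, ← hb2, ← hc3] at hmain
  have hδb : δ * b1 = ε / 16 := by
    rw [hδ]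
    field_simp
  refine le_trans (measure_mono fun y hy => ?_) (hmain.trans ?_)
  · by_contra hno
    simp only [Set.mem_ofPred_eq, not_exists, not_and, not_lt] at hno
    have f1 := hno _ (isURE r c y).1
    have f2 := hno _ ((isOracle r c y).1)
    have f3 := loss_sub_loss_le (hK r c) (μ r c) (α r c) (β r c) (isURE r c y) ((isOracle r c y).1)
    rw [Set.mem_ofPred_eq] at hy
    linarith
  · rw [← ENNReal.ofReal_toReal hatop]
    refine ENNReal.ofReal_le_ofReal ?_
    have g1 : σ ^ 2 / B ≤ a.toReal / 2 := by
      rw [hB, div_div_eq_mul_div, div_le_div_iff₀ (by positivity) two_pos]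
      nlinarith
    have g2 := mul_le_mul_of_nonneg_right hn2 hc3nn
    linarith
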